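/- Let $n\ge 2$, $K\in\{0,1,-1\}$, and let $M$ be the $n$-dimensional space form of curvature $K$ with pole $\mathcal O$, i.e. the manifold with metric $g=dr^2+\psi(r)^2d\theta^2$ in polar coordinates around $\mathcal O$, where $\psi(r)=r$, $r\in[0,\infty)$ if $K=0$ (Euclidean space); $\psi(r)=\sin r$, $r\in[0,\pi)$ if $K=1$ (the unit sphere without the antipode of $\mathcal O$); $\psi(r)=\sinh r$, $r\in[0,\infty)$ if $K=-1$ (hyperbolic space). Closures and boundaries are taken in $M$; $\partial S:=\overline S\setminus S$ for a hypersurface $S$; $\nu$ is the outward unit normal; $\Delta$, $W^{1,2}$ and the Hausdorff measure $\mathcal H_{n-1}$ refer to $g$. Let $\omega\subset\mathbb S^{n-1}$ be a domain (open, connected, non-empty) and let $\Sigma$ be the open cone over $\omega$ with vertex $\mathcal O$, i.e. the union of the open geodesic rays issuing from $\mathcal O$ in the directions of $\omega$. Suppose that $\Sigma$ is convex: $\partial\Sigma\setminus\{\mathcal O\}$ is a smooth boundary of $\Sigma$, and $g(\nabla_X\nu,X)\ge 0$ for all $X$ tangent to it. Let $\Omega_1,\Omega_2\subset\Sigma$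 be bounded domains with $\overline\Omega_2\cap\Sigma\subset\Omega_1$ and $\mathcal O\in\partial\Omega_2$, and put $$\Omega=\Omega_1\setminus\overline\Omega_2,\quad \Gamma_0=\partial\Omega_1\cap\Sigma,\quad \Gamma_2=\partial\Omega_2\cap\Sigma,\quad \Gamma_1=\partial\Omega\setminus(\overline\Gamma_0\cup\overline\Gamma_2).$$ Suppose that $\Omega$ is an annular sector-like domain, that is: $\mathcal H_{n-1}(\Gamma_i)>0$ and $\Gamma_i$ is a smooth $(n-1)$-dimensional manifold for $i=0,1,2$; $\partial\Gamma_0$ and $\partial\Gamma_2$ are contained in $\partial\Omega$ and are smooth $(n-2)$-dimensional manifolds; and $\partial\Gamma_1=\partial\Gamma_0\cup\partial\Gamma_2$. Let $c_0,c_2\in\mathbb R$ and let $v\in C^2(\Omega)\cap C^1(\Omega\cup\Gamma_0\cup\Gamma_1\cup\Gamma_2)\cap W^{1,2}(\Omega)$ satisfy $$\Delta v\ge 0\ \text{in }\Omega,\qquad v=c_0\ \text{on }\Gamma_0,\qquad \frac{\partial v}{\partial\nu}\le 0\ \text{on }\Gamma_1,\qquad v=c_2\ \text{on }\Gamma_2.$$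 Then $v$ attains its maximum over $\Omega\cup\Gamma_0\cup\Gamma_1\cup\Gamma_2$, and $$\max_{\Omega\cup\Gamma_0\cup\Gamma_1\cup\Gamma_2}v=\max\{c_0,c_2\}.$$ If moreover $v$ is defined and continuous on all of $\overline\Omega$, then also $\max_{\overline\Omega}v=\max\{c_0,c_2\}$. -/

import Mathlib

open Set MeasureTheory Metric
open scoped ContDiff ENNReal

noncomputable section

namespace SpaceForm

/-! The simply connected space form of constant curvature `K`, in the conformal coordinates centred
at the pole `O = 0` (Riemann's normal form of a metric of constant curvature):
`g = (1 + K |x|² / 4)⁻² |dx|²` on `{x ∈ ℝⁿ | 1 + K |x|² / 4 > 0}`.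
* `K = 0`: all of `ℝⁿ` with the flat metric;
* `K = 1`: all of `ℝⁿ`, the stereographic image of the unit sphere without the antipode of the pole,
  i.e. `dr² + sin² r dθ²`, `r ∈ [0, π)`, where `|x| = 2 tan (r / 2)`;
* `K = -1`: the ball of radius `2`, i.e. `dr² + sinh² r dθ²`, `r ∈ [0, ∞)`,
  where `|x| = 2 tanh (r / 2)`. -/

variable {n : ℕ}

/-- The coordinate space. -/
abbrev E (n : ℕ) := EuclideanSpace ℝ (Fin n)

/-- The underlying set of the space form of curvature `K`. -/
def M (n : ℕ) (K : ℝ) : Set (E n) := {x | 0 < 1 + K / 4 * ‖x‖ ^ 2}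

/-- The conformal factor: `g = (conf K)² |dx|²`. -/
def conf (K : ℝ) (x : E n) : ℝ := (1 + K / 4 * ‖x‖ ^ 2)⁻¹

/-- The geodesic distance from the pole: the length of the radial segment from `0` to `x`. -/
def poleDist (K : ℝ) (x : E n) : ℝ := ∫ s in (0 : ℝ)..‖x‖, (1 + K / 4 * s ^ 2)⁻¹

/-- The Riemannian volume measure `dV = (conf K)ⁿ dx`. -/
def vol (n : ℕ) (K : ℝ) : Measure (E n) :=
  (volume : Measure (E n)).withDensity fun x => ENNReal.ofReal (conf K x ^ n)

/-- The `(n-1)`-dimensional Hausdorff measure of a hypersurface `S` for the metric `g`. -/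
def area (K : ℝ) (S : Set (E n)) : ℝ≥0∞ :=
  ∫⁻ x in S, ENNReal.ofReal (conf K x ^ (n - 1)) ∂(Measure.hausdorffMeasure ((n : ℝ) - 1))

/-- The Laplace–Beltrami operator `(det g)^(-1/2) ∂ᵢ ((det g)^(1/2) gⁱʲ ∂ⱼ v)`, where
`gᵢⱼ = (conf K)² δᵢⱼ` (and `n ≥ 2`). -/
def laplacian (K : ℝ) (v : E n → ℝ) (x : E n) : ℝ :=
  (conf K x ^ n)⁻¹ *
    ∑ i : Fin n, fderiv ℝ
      (fun y => conf K y ^ (n - 2) * fderiv ℝ v y (EuclideanSpace.single i 1)) x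
      (EuclideanSpace.single i 1)

/-- `w` is the weak `i`-th partial derivative of `v` in the open set `D`. -/
def IsWeakPartial (D : Set (E n)) (i : Fin n) (v w : E n → ℝ) : Prop :=
  LocallyIntegrableOn v D ∧ LocallyIntegrableOn w D ∧
    ∀ φ : E n → ℝ, ContDiff ℝ ∞ φ → HasCompactSupport φ → tsupport φ ⊆ D →
      ∫ x in D, v x * fderiv ℝ φ x (EuclideanSpace.single i 1) = - ∫ x in D, w x * φ x

/-- `v ∈ W^{1,2}(D)` for the metric `g`: `v ∈ L²(D, dV)`, and `v` has weak partial derivatives `wᵢ`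
with `|∇v|_g = (conf K)⁻¹ (∑ wᵢ²)^(1/2) ∈ L²(D, dV)`. -/
def MemW12 (K : ℝ) (D : Set (E n)) (v : E n → ℝ) : Prop :=
  MemLp v 2 ((vol n K).restrict D) ∧
    ∃ w : Fin n → E n → ℝ, ∀ i, IsWeakPartial D i v (w i) ∧
      MemLp (fun x => (conf K x)⁻¹ * w i x) 2 ((vol n K).restrict D)

/-- `S` is a smooth embedded submanifold of codimension `k` (without boundary, not necessarily
closed): locally the zero set of a smooth submersion to `ℝᵏ`. -/
def IsSmoothSubmanifold (k : ℕ) (S : Set (E n)) : Prop :=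
  ∀ p ∈ S, ∃ (U : Set (E n)) (F : E n → EuclideanSpace ℝ (Fin k)),
    IsOpen U ∧ p ∈ U ∧ ContDiffOn ℝ ∞ F U ∧
      (∀ x ∈ U, Function.Surjective (fderiv ℝ F x)) ∧ S ∩ U = {x ∈ U | F x = 0}

/-- `φ` is, in the open set `U`, a smooth defining function of `D`, so that `D` is on one side of
its smooth boundary `{φ = 0}` in `U`. -/
def IsDefiningFunction (D U : Set (E n)) (φ : E n → ℝ) : Prop :=
  IsOpen U ∧ ContDiffOn ℝ ∞ φ U ∧ (∀ x ∈ U, fderiv ℝ φ x ≠ 0) ∧ D ∩ U = {x ∈ U | φ x < 0}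

/-- The field of `g`-unit vectors `∇φ / |∇φ|`; on `{φ = 0}` it is the outward unit normal of
`{φ < 0}`. -/
def unitNormal (K : ℝ) (φ : E n → ℝ) (x : E n) : E n :=
  (conf K x * ‖gradient φ x‖)⁻¹ • gradient φ x

/-- `ν` is the outward `g`-unit normal of `D` at its smooth boundary point `p`. -/
def IsOutwardUnitNormal (K : ℝ) (D : Set (E n)) (p ν : E n) : Prop :=
  ∃ (U : Set (E n)) (φ : E n → ℝ), p ∈ U ∧ IsDefiningFunction D U φ ∧ φ p = 0 ∧
    ν = unitNormal K φ p

/-- The Levi-Civita derivative `∇_X Y` at `p` of the metric `g = e^{2ℓ} |dx|²`, `ℓ = log (conf K)`: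
`D_X Y + dℓ(X) Y + dℓ(Y) X - ⟨X, Y⟩ grad ℓ`. -/
def leviCivita (K : ℝ) (X : E n) (Y : E n → E n) (p : E n) : E n :=
  let l : E n → ℝ := fun x => Real.log (conf K x)
  fderiv ℝ Y p X + fderiv ℝ l p X • Y p + fderiv ℝ l p (Y p) • X
    - inner ℝ X (Y p) • gradient l p

/-- The cone over `W ⊆ S^{n-1}` with vertex at the pole: the union of the open geodesic rays from
the pole in the directions `θ ∈ W`. -/
def cone (K : ℝ) (W : Set (sphere (0 : E n) 1)) : Set (E n) :=
  {x ∈ M n K | ∃ s : ℝ, 0 < s ∧ ∃ θ ∈ W, x = s • (θ : E n)}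

/-- The cone over the domain `W ⊆ S^{n-1}` is convex: its boundary is smooth away from the vertex,
and the second fundamental form `A(X, X) = g(∇_X ν, X)` with respect to the outward unit normal is
nonnegative. -/
def IsConvexCone (K : ℝ) (W : Set (sphere (0 : E n) 1)) : Prop :=
  IsOpen W ∧ IsConnected W ∧
    ∀ p ∈ frontier (cone K W) ∩ M n K, p ≠ 0 →
      ∃ (U : Set (E n)) (φ : E n → ℝ), p ∈ U ∧ IsDefiningFunction (cone K W) U φ ∧ φ p = 0 ∧
        ∀ X : E n, fderiv ℝ φ p X = 0 →
          0 ≤ conf K p ^ 2 * inner ℝ (leviCivita K X (unitNormal K φ) p) X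

/-- The boundary `∂S` of a hypersurface `S`: its closure in the space form, without `S`. -/
def bdry (K : ℝ) (S : Set (E n)) : Set (E n) := (closure S ∩ M n K) \ S

/-- `Ω = Ω₁ \ closure Ω₂`. -/
def Omega (Ω₁ Ω₂ : Set (E n)) : Set (E n) := Ω₁ \ closure Ω₂

/-- `Γ₀ = ∂Ω₁ ∩ Σ`. -/
def Gamma0 (K : ℝ) (W : Set (sphere (0 : E n) 1)) (Ω₁ : Set (E n)) : Set (E n) :=
  frontier Ω₁ ∩ cone K W

/-- `Γ₂ = ∂Ω₂ ∩ Σ`. -/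
def Gamma2 (K : ℝ) (W : Set (sphere (0 : E n) 1)) (Ω₂ : Set (E n)) : Set (E n) :=
  frontier Ω₂ ∩ cone K W

/-- `Γ₁ = ∂Ω \ (closure Γ₀ ∪ closure Γ₂)`, the boundary being taken in the space form. -/
def Gamma1 (K : ℝ) (W : Set (sphere (0 : E n) 1)) (Ω₁ Ω₂ : Set (E n)) : Set (E n) :=
  (frontier (Omega Ω₁ Ω₂) ∩ M n K) \ (closure (Gamma0 K W Ω₁) ∪ closure (Gamma2 K W Ω₂))

/-- The set `Ω ∪ Γ₀ ∪ Γ₁ ∪ Γ₂`. -/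
def OmegaGamma (K : ℝ) (W : Set (sphere (0 : E n) 1)) (Ω₁ Ω₂ : Set (E n)) : Set (E n) :=
  Omega Ω₁ Ω₂ ∪ Gamma0 K W Ω₁ ∪ Gamma1 K W Ω₁ Ω₂ ∪ Gamma2 K W Ω₂

/-- `Ω = Ω₁ \ closure Ω₂` is an annular sector-like domain in the convex cone over `W`. -/
structure IsAnnularSectorLike (K : ℝ) (W : Set (sphere (0 : E n) 1)) (Ω₁ Ω₂ : Set (E n)) :
    Prop where
  convex_cone : IsConvexCone K W
  isOpen₁ : IsOpen Ω₁
  isConnected₁ : IsConnected Ω₁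
  subset₁ : Ω₁ ⊆ cone K W
  bounded₁ : ∃ ρ : ℝ, ∀ x ∈ Ω₁, poleDist K x ≤ ρ
  isOpen₂ : IsOpen Ω₂
  isConnected₂ : IsConnected Ω₂
  subset₂ : Ω₂ ⊆ cone K W
  bounded₂ : ∃ ρ : ℝ, ∀ x ∈ Ω₂, poleDist K x ≤ ρ
  closure_subset : closure Ω₂ ∩ cone K W ⊆ Ω₁
  pole_mem : (0 : E n) ∈ frontier Ω₂
  area_pos₀ : 0 < area K (Gamma0 K W Ω₁)
  area_pos₁ : 0 < area K (Gamma1 K W Ω₁ Ω₂)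
  area_pos₂ : 0 < area K (Gamma2 K W Ω₂)
  smooth₀ : IsSmoothSubmanifold 1 (Gamma0 K W Ω₁)
  smooth₁ : IsSmoothSubmanifold 1 (Gamma1 K W Ω₁ Ω₂)
  smooth₂ : IsSmoothSubmanifold 1 (Gamma2 K W Ω₂)
  bdry_subset₀ : bdry K (Gamma0 K W Ω₁) ⊆ frontier (Omega Ω₁ Ω₂)
  bdry_subset₂ : bdry K (Gamma2 K W Ω₂) ⊆ frontier (Omega Ω₁ Ω₂)
  bdry_smooth₀ : IsSmoothSubmanifold 2 (bdry K (Gamma0 K W Ω₁))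
  bdry_smooth₂ : IsSmoothSubmanifold 2 (bdry K (Gamma2 K W Ω₂))
  bdry_eq : bdry K (Gamma1 K W Ω₁ Ω₂) = bdry K (Gamma0 K W Ω₁) ∪ bdry K (Gamma2 K W Ω₂)

end SpaceForm

end

/-! In conformal coordinates `Δ_g v = conf⁻ⁿ div (a ∇v)` with `a = conf^(n-2)`, so the hypothesis is
`div (a ∇v) ≥ 0` for Euclidean derivatives. Fix `c > max c₀ c₂` and let `G` be `expNegInvGlue`: a
smooth function, zero on `(-∞, 0]`, with values in `[0, 1]` and positive derivative on `(0, ∞)`.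
Testing with `G(v - c) η`, where `η` is a compactly supported cutoff vanishing near `∂Ω`, gives `∫ a
G'(v - c) |∇v|² η ≤ -∫ G(v - c) a ⟨∇v, ∇η⟩`, and the right side is at most `fluxDefect`, the
integral over `{v > c}` of the negative part of `a ⟨∇v, ∇η⟩`. If `η` can be taken equal to `1` on a
given compact set with arbitrarily small defect, then `∇v = 0` wherever `v > c`.

Only this one-sided quantity has to be small, and each piece of the boundary has its own reason.
Near `Γ₀` and `Γ₂` the set `{v > c}` is absent. At `Γ₁` the inequality `∂v/∂ν ≤ 0` makes the flux
through a thin layer almost of the favourable sign. The edges `∂Γ₀`, `∂Γ₂` have codimension two, and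
infinity in the chart (the antipode of the pole when `K = 1`) is a point: for both, cutoffs of
bounded energy exist, supported where the finite Dirichlet energy of `v` tends to zero. The vertex
is never a point of `Γ₁`, so it needs no further case. `exists_cutoff` assembles these cutoffs by
multiplication, and `gradient_eq_zero` draws the conclusion.

Thus `v` is locally constant where it exceeds `max c₀ c₂`. A level set at such a height is open, and
it has no frontier in the connected cone, since it cannot reach `Γ₀` or `Γ₂`. It would be the whole
cone, which is impossible because `Γ₀` is a nonempty part of the cone outside `Ω₁`. This is
`le_max`; continuity then carries the bound to the boundary. -/

noncomputable section

open Filter Topology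
open scoped NNReal

namespace SpaceForm

/-! ### Volume of tubular neighbourhoods -/

section


variable {n : ℕ}

/-- A packing argument: with `G` a right inverse of `F'`, the translates of the tube by `5r G(u)`,
for `u` in an integer grid with about `r⁻ᵏ` points, are pairwise disjoint and lie in one fixed ball.
No change of variables is needed. -/
theorem exists_measure_tube_le {V : Type*} [NormedAddCommGroup V] [NormedSpace ℝ V]
    [FiniteDimensional ℝ V] [MeasurableSpace V] [BorelSpace V] (μ : Measure V)
    [μ.IsAddHaarMeasure] {k : ℕ} {F : V → Fin k → ℝ} {F' : V →L[ℝ] (Fin k → ℝ)} {p : V}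
    (hF : HasStrictFDerivAt F F' p) (hF' : Function.Surjective F') :
    ∃ δ > 0, ∃ C : ℝ, 0 ≤ C ∧ ∀ r > 0,
      μ {x ∈ ball p δ | ‖F x‖ ≤ r} ≤ ENNReal.ofReal (C * r ^ k) := by
  obtain ⟨G, hG⟩ := F'.exists_rightInverse_of_surjective (LinearMap.range_eq_top.2 hF')
  have hG' : ∀ y, F' (G y) = y := fun y => DFunLike.congr_fun hG y
  -- This makes `κ ‖G‖ ≤ 1/2`: along `G`, the linearization error of `F` is at most half of the
  -- displacement.
  set κ : ℝ≥0 := ⟨1 / (2 * (‖G‖ + 1)), by positivity⟩ with hκ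
  have hκ0 : 0 < κ := by
    rw [← NNReal.coe_pos, hκ]
    show 0 < 1 / (2 * (‖G‖ + 1))
    positivity
  obtain ⟨s, hs, hA⟩ := hF.approximates_deriv_on_nhds (c := κ) (Or.inr hκ0)
  obtain ⟨δ, hδ, hδs⟩ := Metric.mem_nhds_iff.1 hs
  have hA := hA.mono_set hδs
  -- With at most `c / r` grid steps of size `5r` in each coordinate, a translation has length at
  -- most `δ`.
  set c : ℝ := δ / (5 * (‖G‖ + 1)) with hc
  have hc0 : 0 < c := by positivity
  refine ⟨δ, hδ, (μ (ball p (2 * δ))).toReal / c ^ k, by positivity, fun r hr => ?_⟩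
  set A := {x ∈ ball p δ | ‖F x‖ ≤ r} with hAdef
  have hAm : MeasurableSet A := by
    obtain ⟨t, ht, hst⟩ := continuousOn_iff_isClosed.1 hA.continuousOn.norm (Iic r) isClosed_Iic
    have : A = t ∩ ball p δ := by
      rw [← hst]; ext x; simp [hAdef, and_comm]
    exact this ▸ ht.measurableSet.inter measurableSet_ball
  set N := ⌊c / r⌋₊ with hN
  have hNr : (N : ℝ) ≤ c / r := Nat.floor_le (by positivity)
  have hNr' : c / r < N + 1 := Nat.lt_floor_add_one _
  let u : (Fin k → Fin (N + 1)) → Fin k → ℝ := fun m i => (m i : ℕ)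
  let T : (Fin k → Fin (N + 1)) → Set V := fun m => (fun x => (5 * r) • G (u m) + x) '' A
  have hGle : ∀ y, ‖G y‖ ≤ ‖G‖ * ‖y‖ := G.le_opNorm
  have hT : ∀ m, T m ⊆ ball p (2 * δ) := by
    rintro m _ ⟨x, hx, rfl⟩
    have hu : ‖u m‖ ≤ N := by
      refine (pi_norm_le_iff_of_nonneg (by positivity)).2 fun i => ?_
      simp only [u, Real.norm_natCast]
      exact_mod_cast Nat.lt_succ_iff.1 (m i).2
    have h1 : ‖(5 * r) • G (u m)‖ ≤ δ := by
      rw [norm_smul, Real.norm_of_nonneg (by positivity)]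
      calc 5 * r * ‖G (u m)‖ ≤ 5 * r * ((‖G‖ + 1) * (c / r)) := by
            gcongr
            refine (hGle _).trans ?_
            gcongr
            · linarith
            · exact hu.trans hNr
        _ = δ := by rw [hc]; field_simp
    have h2 : ‖x - p‖ < δ := by simpa [dist_eq_norm] using hx.1
    rw [mem_ball, dist_eq_norm, add_sub_assoc]
    refine (norm_add_le _ _).trans_lt (by linarith)
  -- A common point of two translates would give `x`, `y` in the tube with `‖F y - F x‖ ≥ 5r/2`,
  -- while both values have norm at most `r`.
  have hdisj : Pairwise (Function.onFun Disjoint T) := by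
    intro m m' hmm
    refine Set.disjoint_left.2 ?_
    rintro _ ⟨x, hx, rfl⟩ ⟨y, hy, hxy⟩
    have hu1 : 1 ≤ ‖u m - u m'‖ := by
      obtain ⟨i, hi⟩ := Function.ne_iff.1 hmm
      refine le_trans ?_ (norm_le_pi_norm (u m - u m') i)
      have : ((m i : ℕ) : ℤ) - (m' i : ℕ) ≠ 0 := by
        have := Fin.val_ne_of_ne hi
        omega
      have h3 := Int.one_le_abs this
      simp only [u, Pi.sub_apply, Real.norm_eq_abs]
      exact_mod_cast h3
    have hyx : y - x = (5 * r) • G (u m - u m') := by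
      rw [map_sub, smul_sub]
      simp only at hxy
      rw [sub_eq_sub_iff_add_eq_add, ← hxy]; abel
    have h4 := hA y hy.1 x hx.1
    rw [hyx, map_smul, hG'] at h4
    have h5 : ‖(5 * r) • (u m - u m')‖ = 5 * r * ‖u m - u m'‖ := by
      rw [norm_smul, Real.norm_of_nonneg (by positivity)]
    have h6 : ‖(5 * r) • G (u m - u m')‖ ≤ 5 * r * (‖G‖ * ‖u m - u m'‖) := by
      rw [norm_smul, Real.norm_of_nonneg (by positivity)]
      gcongr
      exact hGle _
    have h7 : (κ : ℝ) * (5 * r * (‖G‖ * ‖u m - u m'‖)) ≤ 5 * r * ‖u m - u m'‖ / 2 := by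
      have : (κ : ℝ) * ‖G‖ ≤ 1 / 2 := by
        show 1 / (2 * (‖G‖ + 1)) * ‖G‖ ≤ 1 / 2
        rw [div_mul_eq_mul_div, div_le_div_iff₀ (by positivity) (by positivity)]
        linarith
      nlinarith [mul_nonneg (mul_nonneg (by norm_num : (0:ℝ) ≤ 5) hr.le) (norm_nonneg (u m - u m'))]
    have h8 : ‖F y - F x‖ ≤ 2 * r := (norm_sub_le _ _).trans (by linarith [hx.2, hy.2])
    have h9 : ‖(5 * r) • (u m - u m')‖ ≤ ‖F y - F x‖ + ‖F y - F x - (5 * r) • (u m - u m')‖ := by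
      have := norm_sub_le (F y - F x) (F y - F x - (5 * r) • (u m - u m'))
      simpa using this
    have h10 := h4.trans ((mul_le_mul_of_nonneg_left h6 κ.2).trans h7)
    nlinarith
  have hTm : ∀ m, MeasurableSet (T m) := fun m =>
    (measurableEmbedding_addLeft _).measurableSet_image.2 hAm
  have hμT : ∀ m, μ (T m) = μ A := fun m => by
    simp only [T]
    rw [image_add_left, measure_preimage_add]
  have hsum : ((N + 1 : ℕ) : ℝ≥0∞) ^ k * μ A ≤ μ (ball p (2 * δ)) := by
    calc ((N + 1 : ℕ) : ℝ≥0∞) ^ k * μ A = ∑ m : Fin k → Fin (N + 1), μ (T m) := by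
          simp [hμT]
      _ = μ (⋃ m, T m) := by
          rw [measure_iUnion hdisj hTm, tsum_fintype]
      _ ≤ _ := measure_mono (iUnion_subset hT)
  have hfin : μ (ball p (2 * δ)) ≠ ⊤ := measure_ball_lt_top.ne
  have hAfin : μ A ≠ ⊤ := ne_top_of_le_ne_top hfin
    (measure_mono fun x hx => ball_subset_ball (by linarith) hx.1)
  rw [← ENNReal.ofReal_toReal hAfin]
  refine ENNReal.ofReal_le_ofReal ?_
  have h := ENNReal.toReal_mono hfin hsum
  rw [ENNReal.toReal_mul, ENNReal.toReal_pow, ENNReal.toReal_natCast] at h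
  push_cast at h
  rw [div_mul_eq_mul_div, le_div_iff₀ (by positivity)]
  have h11 : c ≤ r * (N + 1) := by
    rw [div_lt_iff₀ hr] at hNr'
    linarith
  calc (μ A).toReal * c ^ k ≤ (μ A).toReal * (r * (N + 1)) ^ k := by gcongr
    _ = ((N + 1 : ℝ) ^ k * (μ A).toReal) * r ^ k := by rw [mul_pow]; ring
    _ ≤ _ := by gcongr

end

/-! ### Cutoff functions and removable sets -/

section


variable {n : ℕ}

/-- A smooth nonincreasing function equal to `1` on `(-∞, 1]` and to `0` on `[2, ∞)`. -/
def cutoff (t : ℝ) : ℝ := Real.smoothTransition (2 - t)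

theorem contDiff_cutoff {m : ℕ∞} : ContDiff ℝ m cutoff :=
  Real.smoothTransition.contDiff.comp (contDiff_const.sub contDiff_id)

theorem cutoff_nonneg (t : ℝ) : 0 ≤ cutoff t := Real.smoothTransition.nonneg _

theorem cutoff_le_one (t : ℝ) : cutoff t ≤ 1 := Real.smoothTransition.le_one _

theorem cutoff_of_le {t : ℝ} (ht : t ≤ 1) : cutoff t = 1 :=
  Real.smoothTransition.one_of_one_le (by linarith)

theorem cutoff_of_ge {t : ℝ} (ht : 2 ≤ t) : cutoff t = 0 :=
  Real.smoothTransition.zero_of_nonpos (by linarith)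

theorem differentiable_cutoff : Differentiable ℝ cutoff :=
  (contDiff_cutoff (m := 1)).differentiable (by norm_num)

theorem deriv_cutoff_nonpos (t : ℝ) : deriv cutoff t ≤ 0 :=
  Antitone.deriv_nonpos fun x y hxy => Real.smoothTransition.monotone (by linarith)

theorem exists_deriv_cutoff_bound : ∃ C : ℝ, 0 ≤ C ∧ ∀ t, |deriv cutoff t| ≤ C := by
  have hc : Continuous (deriv cutoff) :=
    (contDiff_cutoff (m := 1)).continuous_deriv (by norm_num)
  obtain ⟨C, hC⟩ := isCompact_Icc.exists_bound_of_continuousOn (s := Icc (1 : ℝ) 2) hc.continuousOn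
  refine ⟨max C 0, le_max_right _ _, fun t => ?_⟩
  by_cases ht : t ∈ Icc (1 : ℝ) 2
  · exact (hC t ht).trans (le_max_left _ _)
  · have h0 : deriv cutoff t = 0 := by
      rw [mem_Icc, not_and_or, not_le, not_le] at ht
      rcases ht with ht | ht
      · have : cutoff =ᶠ[𝓝 t] fun _ => 1 := by
          filter_upwards [Iio_mem_nhds ht] with x hx using cutoff_of_le (le_of_lt hx)
        rw [this.deriv_eq, deriv_const]
      · have : cutoff =ᶠ[𝓝 t] fun _ => 0 := by
          filter_upwards [Ioi_mem_nhds ht] with x hx using cutoff_of_ge (le_of_lt hx)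
        rw [this.deriv_eq, deriv_const]
    rw [h0, abs_zero]
    exact le_max_right _ _

theorem exists_bump (p : E n) {δ : ℝ} (hδ : 0 < δ) :
    ∃ χ : E n → ℝ, ContDiff ℝ ∞ χ ∧ (∀ x, χ x ∈ Icc (0 : ℝ) 1) ∧
      (∀ x ∈ ball p (δ / 4), χ x = 1) ∧ tsupport χ ⊆ closedBall p (δ / 2) := by
  let f : ContDiffBump p := ⟨δ / 4, δ / 2, by linarith, by linarith⟩
  exact ⟨f, f.contDiff, fun x => ⟨f.nonneg, f.le_one⟩,
    fun x hx => f.one_of_mem_closedBall (ball_subset_closedBall hx), f.tsupport_eq.le⟩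

/-- `1` off the support of `χ`, and `0` where `χ = 1` and `g ≤ 1`. -/
def collar (χ g : E n → ℝ) (x : E n) : ℝ := 1 - χ x * cutoff (g x)

section Collar

variable {χ g : E n → ℝ} {U : Set (E n)}

theorem collar_mem_Icc (hχ : ∀ x, χ x ∈ Icc (0 : ℝ) 1) (x : E n) :
    collar χ g x ∈ Icc (0 : ℝ) 1 := by
  have h1 := hχ x
  have h2 := cutoff_nonneg (g x)
  have h3 := cutoff_le_one (g x)
  constructor
  · have := mul_le_one₀ h1.2 h2 h3
    simp only [collar]; linarith
  · have := mul_nonneg h1.1 h2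
    simp only [collar]; linarith

theorem collar_of_notMem {x : E n} (hx : x ∉ tsupport χ) : collar χ g x = 1 := by
  simp [collar, image_eq_zero_of_notMem_tsupport hx]

theorem collar_eventuallyEq_one {x : E n} (hx : x ∉ tsupport χ) :
    collar χ g =ᶠ[𝓝 x] fun _ => 1 := by
  filter_upwards [(isClosed_tsupport χ).isOpen_compl.mem_nhds hx] with y hy
    using collar_of_notMem hy

theorem contDiff_collar (hχ : ContDiff ℝ ∞ χ) (hU : IsOpen U) (hg : ContDiffOn ℝ ∞ g U)
    (hs : tsupport χ ⊆ U) : ContDiff ℝ 1 (collar χ g) := by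
  refine contDiff_iff_contDiffAt.2 fun x => ?_
  by_cases hx : x ∈ tsupport χ
  · have h1 : ContDiffAt ℝ 1 g x := (hg.contDiffAt (hU.mem_nhds (hs hx))).of_le (by simp)
    have h2 : ContDiffAt ℝ 1 χ x := hχ.contDiffAt.of_le (by simp)
    exact contDiffAt_const.sub (h2.mul ((contDiff_cutoff (m := 1)).contDiffAt.comp x h1))
  · exact contDiffAt_const.congr_of_eventuallyEq (collar_eventuallyEq_one hx)

theorem fderiv_collar_of_notMem {x : E n} (hx : x ∉ tsupport χ) : fderiv ℝ (collar χ g) x = 0 := by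
  rw [(collar_eventuallyEq_one hx).fderiv_eq]; simp

theorem fderiv_collar (hχ : ContDiff ℝ ∞ χ) {x : E n} (hg : DifferentiableAt ℝ g x) :
    fderiv ℝ (collar χ g) x =
      -((χ x * deriv cutoff (g x)) • fderiv ℝ g x + cutoff (g x) • fderiv ℝ χ x) := by
  have h1 : HasFDerivAt χ (fderiv ℝ χ x) x :=
    (hχ.differentiable (by simp) x).hasFDerivAt
  have h2 : HasFDerivAt (fun y => cutoff (g y)) (deriv cutoff (g x) • fderiv ℝ g x) x :=
    (differentiable_cutoff (g x)).hasDerivAt.comp_hasFDerivAt x hg.hasFDerivAt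
  have h3 := (h1.mul h2).const_sub 1
  rw [mul_smul]
  exact h3.fderiv

theorem fderiv_collar_of_two_lt {x : E n} (hg : ContinuousAt g x) (hx : 2 < g x) :
    fderiv ℝ (collar χ g) x = 0 := by
  have : collar χ g =ᶠ[𝓝 x] fun _ => 1 := by
    filter_upwards [hg.eventually (Ioi_mem_nhds hx)] with y hy
    simp [collar, cutoff_of_ge (le_of_lt hy)]
  rw [this.fderiv_eq]; simp

theorem collar_eventuallyEq_zero {x : E n} (hχ : ∀ᶠ y in 𝓝 x, χ y = 1) (hg : ContinuousAt g x)
    (hx : g x < 1) : collar χ g =ᶠ[𝓝 x] fun _ => 0 := by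
  filter_upwards [hχ, hg.eventually (Iio_mem_nhds hx)] with y hy1 hy2
  simp [collar, hy1, cutoff_of_le (le_of_lt hy2)]

end Collar

/-- The total negative part of the density `a ⟨∇v, ∇η⟩` on `A`. -/
def fluxDefect (a v : E n → ℝ) (A : Set (E n)) (η : E n → ℝ) : ℝ≥0∞ :=
  ∫⁻ x in A, ENNReal.ofReal (-(a x * fderiv ℝ η x (gradient v x)))

/-- `s` can be cut off, away from `Q`, with arbitrarily small flux defect. -/
def Removable (a v : E n → ℝ) (A Q s : Set (E n)) : Prop :=
  ∀ ε : ℝ, 0 < ε → ∃ η : E n → ℝ, ContDiff ℝ 1 η ∧ (∀ x, η x ∈ Icc (0 : ℝ) 1) ∧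
    (∀ x ∈ s, η =ᶠ[𝓝 x] fun _ => 0) ∧ (∀ x ∈ Q, η x = 1) ∧
      fluxDefect a v A η ≤ ENNReal.ofReal ε

/-! ### Calculus of flux defects and removable sets. -/

variable {a v : E n → ℝ} {A Q s t : Set (E n)}

theorem measurable_gradient (v : E n → ℝ) : Measurable (gradient v) :=
  (InnerProductSpace.toDual ℝ (E n)).symm.continuous.measurable.comp (measurable_fderiv ℝ v)

theorem measurable_fluxDensity (ha : Measurable a) (η : E n → ℝ) :
    Measurable fun x => a x * fderiv ℝ η x (gradient v x) := by
  have h : Measurable fun x => fderiv ℝ η x (gradient v x) :=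
    isBoundedBilinearMap_apply.continuous.measurable.comp
      ((measurable_fderiv ℝ η).prodMk (measurable_gradient v))
  exact ha.mul h

/-- By the product rule, as the factors lie in `[0, 1]` and the positive part is subadditive. This
is what lets cutoffs for different pieces of the boundary be multiplied. -/
theorem fluxDefect_mul_le (ha : Measurable a) (hA : MeasurableSet A)
    {η₁ η₂ : E n → ℝ} (h₁ : ContDiff ℝ 1 η₁) (h₂ : ContDiff ℝ 1 η₂)
    (hi₁ : ∀ x, η₁ x ∈ Icc (0 : ℝ) 1) (hi₂ : ∀ x, η₂ x ∈ Icc (0 : ℝ) 1) :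
    fluxDefect a v A (fun x => η₁ x * η₂ x) ≤ fluxDefect a v A η₁ + fluxDefect a v A η₂ := by
  unfold fluxDefect
  have hm : Measurable fun x => ENNReal.ofReal (-(a x * fderiv ℝ η₁ x (gradient v x))) :=
    (measurable_fluxDensity ha η₁).neg.ennreal_ofReal
  rw [← lintegral_add_left hm]
  refine setLIntegral_mono' hA fun x hx => ?_
  have hd₁ := (h₁.differentiable (by norm_num) x).hasFDerivAt
  have hd₂ := (h₂.differentiable (by norm_num) x).hasFDerivAt
  rw [show fderiv ℝ (fun x => η₁ x * η₂ x) x = _ from (hd₁.mul hd₂).fderiv]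
  simp only [add_apply, smul_apply, smul_eq_mul]
  have key : ∀ y z : ℝ, 0 ≤ z → z ≤ 1 → ENNReal.ofReal (z * y) ≤ ENNReal.ofReal y := by
    intro y z hz hz1
    rcases le_total 0 y with hy | hy
    · exact ENNReal.ofReal_le_ofReal (mul_le_of_le_one_left hy hz1)
    · rw [ENNReal.ofReal_of_nonpos (mul_nonpos_of_nonneg_of_nonpos hz hy)]
      exact zero_le
  calc _ = ENNReal.ofReal (η₂ x * -(a x * fderiv ℝ η₁ x (gradient v x)) +
        η₁ x * -(a x * fderiv ℝ η₂ x (gradient v x))) := by congr 1; ring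
    _ ≤ _ := ENNReal.ofReal_add_le.trans
      (add_le_add (key _ _ (hi₂ x).1 (hi₂ x).2) (key _ _ (hi₁ x).1 (hi₁ x).2))

theorem Removable.mono (h : Removable a v A Q t) (hst : s ⊆ t) : Removable a v A Q s :=
  fun ε hε => let ⟨η, h1, h2, h3, h4⟩ := h ε hε
    ⟨η, h1, h2, fun x hx => h3 x (hst hx), h4⟩

theorem removable_empty : Removable a v A Q ∅ := fun ε _ =>
  ⟨fun _ => 1, contDiff_const, fun _ => by simp, by simp, by simp, by simp [fluxDefect]⟩

theorem eventuallyEq_zero_mul {η₁ η₂ : E n → ℝ} {x : E n}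
    (h : η₁ =ᶠ[𝓝 x] (fun _ => 0) ∨ η₂ =ᶠ[𝓝 x] fun _ => 0) :
    (fun y => η₁ y * η₂ y) =ᶠ[𝓝 x] fun _ => 0 := by
  rcases h with h | h <;> filter_upwards [h] with y hy <;> simp [hy]

theorem mul_mem_Icc {y z : ℝ} (hy : y ∈ Icc (0 : ℝ) 1) (hz : z ∈ Icc (0 : ℝ) 1) :
    y * z ∈ Icc (0 : ℝ) 1 :=
  ⟨mul_nonneg hy.1 hz.1, mul_le_one₀ hy.2 hz.1 hz.2⟩

/-- If the smaller set `s` is removable, then only the part of `t` off a neighbourhood of `s` has to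
be dealt with. -/
theorem Removable.of_diff_open (ha : Measurable a)
    (hA : MeasurableSet A) (hs : Removable a v A Q s)
    (ht : ∀ O, IsOpen O → s ⊆ O → Removable a v A Q (t \ O)) : Removable a v A Q t := by
  intro ε hε
  obtain ⟨η₁, h1, h2, h3, h4, h5⟩ := hs (ε / 2) (by linarith)
  obtain ⟨η₂, k1, k2, k3, k4, k5⟩ := ht (interior {y | η₁ y = 0}) isOpen_interior
    (fun x hx => mem_interior_iff_mem_nhds.2 (h3 x hx)) (ε / 2) (by linarith)
  refine ⟨fun x => η₁ x * η₂ x, h1.mul k1, fun x => mul_mem_Icc (h2 x) (k2 x), fun x hx => ?_,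
    fun x hx => by simp [h4 x hx, k4 x hx], ?_⟩
  · by_cases hx' : x ∈ interior {y | η₁ y = 0}
    · exact eventuallyEq_zero_mul (Or.inl (mem_interior_iff_mem_nhds.1 hx'))
    · exact eventuallyEq_zero_mul (Or.inr (k3 x ⟨hx, hx'⟩))
  · refine (fluxDefect_mul_le ha hA h1 k1 h2 k2).trans ((add_le_add h5 k5).trans ?_)
    rw [← ENNReal.ofReal_add (by linarith) (by linarith), add_halves]

theorem Removable.union (ha : Measurable a)
    (hA : MeasurableSet A) (hs : Removable a v A Q s) (ht : Removable a v A Q t) :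
    Removable a v A Q (s ∪ t) :=
  hs.of_diff_open ha hA fun _ _ hO => ht.mono fun _ hx =>
    hx.1.resolve_left fun h => hx.2 (hO h)

theorem removable_of_isCompact (ha : Measurable a)
    (hA : MeasurableSet A) (hs : IsCompact s)
    (h : ∀ x ∈ s, ∃ t ∈ 𝓝 x, Removable a v A Q (t ∩ s)) : Removable a v A Q s :=
  hs.induction_on removable_empty (fun _ _ hst ht => ht.mono hst)
    (fun _ _ hs ht => hs.union ha hA ht)
    fun x hx => let ⟨t, ht, h⟩ := h x hx
      ⟨t ∩ s, inter_comm t s ▸ inter_mem_nhdsWithin s ht, h⟩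

/-- The collar varies only where `A` is absent, so its defect is zero. Meant for points of `Γ₀` and
`Γ₂`, with `A = {v > c}`. -/
theorem exists_removable_nhds_of_disjoint {p : E n} (hQ : IsClosed Q) (hp : p ∉ Q)
    (hA : ∀ᶠ x in 𝓝 p, x ∉ A) : ∃ t ∈ 𝓝 p, Removable a v A Q t := by
  obtain ⟨δ, hδ, h⟩ := Metric.eventually_nhds_iff_ball.1
    (hA.and (hQ.isOpen_compl.mem_nhds hp))
  obtain ⟨χ, hχ, hχ01, hχ1, hχs⟩ := exists_bump p hδ
  have hsub : tsupport χ ⊆ ball p δ := hχs.trans (closedBall_subset_ball (by linarith))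
  refine ⟨ball p (δ / 4), ball_mem_nhds _ (by linarith), fun ε _ =>
    ⟨collar χ fun _ => 0, contDiff_collar hχ isOpen_univ contDiffOn_const (subset_univ _),
      collar_mem_Icc hχ01, fun x hx => ?_, fun x hx => ?_, ?_⟩⟩
  · refine collar_eventuallyEq_zero ?_ continuousAt_const one_pos
    filter_upwards [isOpen_ball.mem_nhds hx] with y hy using hχ1 y hy
  · exact collar_of_notMem fun h' => (h x (hsub h')).2 hx
  · have : fluxDefect a v A (collar χ fun _ => 0) = 0 := by
      refine le_antisymm ((setLIntegral_mono measurable_const fun x hx => ?_).trans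
        lintegral_zero.le) (zero_le)
      rw [fderiv_collar_of_notMem fun h' => (h x (hsub h')).1 hx]
      simp
    simp [this]

/-- Young's inequality with weight `r`; the energy of `v` is charged only on the set `S` where `η`
varies. -/
theorem fluxDefect_le (ha : Measurable a) (ha0 : ∀ x ∈ A, 0 ≤ a x) (hA : MeasurableSet A)
    {S : Set (E n)} (hS : MeasurableSet S) {η : E n → ℝ} (hη : ∀ x ∈ A, x ∉ S → fderiv ℝ η x = 0)
    {r : ℝ} (hr : 0 < r) :
    fluxDefect a v A η ≤
      (ENNReal.ofReal r * ∫⁻ x in A ∩ S, ENNReal.ofReal (a x * ‖gradient v x‖ ^ 2)) +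
      ENNReal.ofReal r⁻¹ * ∫⁻ x in A, ENNReal.ofReal (a x * ‖fderiv ℝ η x‖ ^ 2) := by
  have hm1 : Measurable fun x => ENNReal.ofReal (a x * ‖gradient v x‖ ^ 2) :=
    (ha.mul ((measurable_gradient v).norm.pow_const 2)).ennreal_ofReal
  rw [inter_comm, ← setLIntegral_indicator hS, ← lintegral_const_mul _ (hm1.indicator hS),
    ← lintegral_const_mul' _ _ ENNReal.ofReal_ne_top,
    ← lintegral_add_left ((hm1.indicator hS).const_mul _)]
  refine setLIntegral_mono' hA fun x hx => ?_
  by_cases hxS : x ∈ S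
  · rw [indicator_of_mem hxS, ← ENNReal.ofReal_mul hr.le, ← ENNReal.ofReal_mul (by positivity),
      ← ENNReal.ofReal_add (by have := ha0 x hx; positivity) (by have := ha0 x hx; positivity)]
    refine ENNReal.ofReal_le_ofReal ?_
    have h1 : -(fderiv ℝ η x (gradient v x)) ≤ ‖fderiv ℝ η x‖ * ‖gradient v x‖ :=
      (neg_le_abs _).trans ((fderiv ℝ η x).le_opNorm _)
    have h2 : ‖fderiv ℝ η x‖ * ‖gradient v x‖ ≤
        r * ‖gradient v x‖ ^ 2 + r⁻¹ * ‖fderiv ℝ η x‖ ^ 2 := by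
      have h3 : r⁻¹ * (r * ‖gradient v x‖ - ‖fderiv ℝ η x‖) ^ 2 =
        r * ‖gradient v x‖ ^ 2 + r⁻¹ * ‖fderiv ℝ η x‖ ^ 2
          - 2 * (‖fderiv ℝ η x‖ * ‖gradient v x‖) := by field_simp; ring
      have h4 : 0 ≤ r⁻¹ * (r * ‖gradient v x‖ - ‖fderiv ℝ η x‖) ^ 2 := by positivity
      have h5 : 0 ≤ ‖fderiv ℝ η x‖ * ‖gradient v x‖ := by positivity
      linarith
    have := mul_le_mul_of_nonneg_left (h1.trans h2) (ha0 x hx)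
    linarith
  · simp [hη x hx hxS]

/-- The energies of the cutoffs need only stay bounded, which is all that the critical scaling
provides: a large weight `r` makes their term small, and afterwards `j` is taken so large that `v`
has little energy on `S j`. -/
theorem exists_fluxDefect_le (ha : Measurable a) (ha0 : ∀ x ∈ A, 0 ≤ a x) (hA : MeasurableSet A)
    {S : ℕ → Set (E n)} (hS : ∀ j, MeasurableSet (S j)) {η : ℕ → E n → ℝ}
    (hη : ∀ j, ∀ x ∈ A, x ∉ S j → fderiv ℝ (η j) x = 0) {C : ℝ} (hC0 : 0 ≤ C)
    (hC : ∀ j, ∫⁻ x in A, ENNReal.ofReal (a x * ‖fderiv ℝ (η j) x‖ ^ 2) ≤ ENNReal.ofReal C)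
    (hlim : Tendsto (fun j => ∫⁻ x in A ∩ S j, ENNReal.ofReal (a x * ‖gradient v x‖ ^ 2))
      atTop (𝓝 0)) {ε : ℝ} (hε : 0 < ε) :
    ∃ j, fluxDefect a v A (η j) ≤ ENNReal.ofReal ε := by
  set r : ℝ := 2 * C / ε + 1
  have hr : 0 < r := by positivity
  have hlim' := ENNReal.Tendsto.const_mul (a := ENNReal.ofReal r) hlim
    (Or.inr ENNReal.ofReal_ne_top)
  rw [mul_zero] at hlim'
  obtain ⟨j, hj⟩ := (hlim'.eventually_le_const
    (ENNReal.ofReal_pos.2 (half_pos hε))).exists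
  refine ⟨j, (fluxDefect_le ha ha0 hA (hS j) (hη j) hr).trans ?_⟩
  have h2 : ENNReal.ofReal r⁻¹ * ENNReal.ofReal C ≤ ENNReal.ofReal (ε / 2) := by
    rw [← ENNReal.ofReal_mul (by positivity)]
    refine ENNReal.ofReal_le_ofReal ?_
    rw [inv_mul_le_iff₀ hr]
    have : r * (ε / 2) = C + ε / 2 := by simp only [r]; field_simp
    linarith
  refine (add_le_add hj ((mul_le_mul_right (hC j) _).trans h2)).trans ?_
  rw [← ENNReal.ofReal_add (by linarith) (by linarith), add_halves]

end

/-! ### Removable sets of codimension two -/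

section


variable {n : ℕ} {a v : E n → ℝ} {A Q s t : Set (E n)}

theorem setLIntegral_ofReal_le {f : E n → ℝ} {S : Set (E n)} (hA : MeasurableSet A)
    (hS : MeasurableSet S) {C : ℝ} (h : ∀ x ∈ A, x ∈ S → f x ≤ C) (h' : ∀ x ∈ A, x ∉ S → f x ≤ 0) :
    ∫⁻ x in A, ENNReal.ofReal (f x) ≤ ENNReal.ofReal C * volume S := by
  calc ∫⁻ x in A, ENNReal.ofReal (f x) ≤ ∫⁻ x in A, S.indicator (fun _ => ENNReal.ofReal C) x := by
        refine setLIntegral_mono' hA fun x hx => ?_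
        by_cases hxS : x ∈ S
        · rw [indicator_of_mem hxS]; exact ENNReal.ofReal_le_ofReal (h x hx hxS)
        · rw [indicator_of_notMem hxS, ENNReal.ofReal_of_nonpos (h' x hx hxS)]
    _ ≤ ∫⁻ x, S.indicator (fun _ => ENNReal.ofReal C) x := setLIntegral_le_lintegral _ _
    _ = _ := by rw [lintegral_indicator hS, setLIntegral_const]

/-- Cutting off at distance about `r` costs a gradient of order `1/r` on a tube of volume of order
`r²`. The energy is bounded in `r`, while the Dirichlet energy of `v` on the tube tends to zero with
its volume. -/
theorem exists_removable_nhds_codim_two (ha : Measurable a) (ha0 : ∀ x ∈ A, 0 ≤ a x)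
    (hA : MeasurableSet A) (hfin : ∫⁻ x in A, ENNReal.ofReal (a x * ‖gradient v x‖ ^ 2) ≠ ⊤)
    {p : E n} (hac : ContinuousAt a p) (hQ : IsClosed Q) (hp : p ∉ Q) {U : Set (E n)}
    (hU : IsOpen U) (hpU : p ∈ U) {F : E n → EuclideanSpace ℝ (Fin 2)} (hF : ContDiffOn ℝ ∞ F U)
    (hF' : Function.Surjective (fderiv ℝ F p)) :
    ∃ t ∈ 𝓝 p, Removable a v A Q (t ∩ {x ∈ U | F x = 0}) := by
  have hFp : ContDiffAt ℝ ∞ F p := hF.contDiffAt (hU.mem_nhds hpU)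
  have hstrict : HasStrictFDerivAt F (fderiv ℝ F p) p := hFp.hasStrictFDerivAt (by simp)
  let e := PiLp.continuousLinearEquiv 2 ℝ fun _ : Fin 2 => ℝ
  have hstrict' : HasStrictFDerivAt (fun x => e (F x)) ((e : _ →L[ℝ] _) ∘L fderiv ℝ F p) p :=
    e.hasStrictFDerivAt.comp p hstrict
  obtain ⟨δ₁, hδ₁, C, hC0, hC⟩ := exists_measure_tube_le (volume : Measure (E n)) hstrict'
    (e.surjective.comp hF')
  have hle : ∀ x, ‖e (F x)‖ ≤ ‖F x‖ := fun x =>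
    (pi_norm_le_iff_of_nonneg (norm_nonneg _)).2 fun i => PiLp.norm_apply_le (F x) i
  set a₀ := a p + 1
  set L := ‖fderiv ℝ F p‖ + 1
  have hL0 : 0 ≤ L := by positivity
  have hev1 : ∀ᶠ x in 𝓝 p, a x < a₀ := hac.eventually_lt_const (by simp [a₀])
  have hev2 : ∀ᶠ x in 𝓝 p, ‖fderiv ℝ F x‖ < L :=
    ((hFp.continuousAt_fderiv (by simp)).norm).eventually_lt_const (by simp [L])
  have hev3 : ∀ᶠ x in 𝓝 p, x ∉ Q := hQ.isOpen_compl.mem_nhds hp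
  have hev4 : ∀ᶠ x in 𝓝 p, x ∈ U := hU.mem_nhds hpU
  have hev5 : ∀ᶠ x in 𝓝 p, x ∈ ball p δ₁ := ball_mem_nhds p hδ₁
  obtain ⟨δ, hδ, h⟩ := Metric.eventually_nhds_iff_ball.1
    (hev1.and (hev2.and (hev3.and (hev4.and hev5))))
  obtain ⟨χ, hχ, hχ01, hχ1, hχs⟩ := exists_bump p hδ
  have hsub : tsupport χ ⊆ ball p δ := hχs.trans (closedBall_subset_ball (by linarith))
  have hsubU : tsupport χ ⊆ U := fun x hx => (h x (hsub hx)).2.2.2.1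
  obtain ⟨Cχ, hCχ⟩ : ∃ Cχ, ∀ x, ‖fderiv ℝ χ x‖ ≤ Cχ :=
    (hχ.continuous_fderiv (by simp)).bounded_above_of_compact_support
      ((HasCompactSupport.of_support_subset_isCompact (isCompact_closedBall p (δ / 2))
        ((subset_tsupport χ).trans hχs)).fderiv ℝ)
  have hCχ0 : 0 ≤ Cχ := (norm_nonneg _).trans (hCχ p)
  obtain ⟨Cβ, hCβ0, hCβ⟩ := exists_deriv_cutoff_bound
  let r : ℕ → ℝ := fun j => 1 / ((j : ℝ) + 1)
  have hr : ∀ j, 0 < r j := fun j => by positivity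
  have hr1 : ∀ j, r j ≤ 1 := fun j => by
    rw [div_le_one (by positivity)]; linarith [(Nat.cast_nonneg j : (0 : ℝ) ≤ j)]
  -- The square keeps `g j` smooth on the zero set of `F`. The cutoff varies only where `‖F‖² ≤ 2
  -- r²`, hence inside the tube of radius `2r`.
  let g : ℕ → E n → ℝ := fun j x => ‖F x‖ ^ 2 / r j ^ 2
  -- A measurable hull, because nothing is known about `F` outside `U`.
  let S : ℕ → Set (E n) := fun j => toMeasurable volume {x ∈ ball p δ₁ | ‖e (F x)‖ ≤ 2 * r j}
  have hgU : ∀ j, ContDiffOn ℝ ∞ (g j) U := fun j => (hF.norm_sq ℝ).div_const _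
  have hS : ∀ j, volume (S j) ≤ ENNReal.ofReal (C * (2 * r j) ^ 2) := fun j => by
    rw [measure_toMeasurable]; exact hC _ (by have := hr j; positivity)
  have hgc : ∀ j, ∀ x ∈ U, ContinuousAt (g j) x := fun j x hx =>
    ((hgU j).contDiffAt (hU.mem_nhds hx)).continuousAt
  have hzero : ∀ j x, x ∉ S j → fderiv ℝ (collar χ (g j)) x = 0 := by
    intro j x hx
    by_cases hxt : x ∈ tsupport χ
    · refine fderiv_collar_of_two_lt (hgc j x (hsubU hxt)) ?_
      by_contra hcon
      refine hx (subset_toMeasurable _ _ ⟨(h x (hsub hxt)).2.2.2.2, (hle x).trans ?_⟩)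
      have : ‖F x‖ ^ 2 ≤ 2 * r j ^ 2 := by
        rw [not_lt, div_le_iff₀ (by have := hr j; positivity)] at hcon
        exact hcon
      refine abs_le_of_sq_le_sq' ?_ (by have := hr j; positivity) |>.2
      nlinarith [sq_nonneg (r j)]
    · exact fderiv_collar_of_notMem hxt
  set D := Cβ * 4 * L + Cχ with hD
  have hD0 : 0 ≤ D := by positivity
  have hbound : ∀ j x, x ∈ ball p δ → ‖fderiv ℝ (collar χ (g j)) x‖ ≤ D / r j := by
    intro j x hxb
    have hrj := hr j
    by_cases hxt : x ∈ tsupport χ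
    swap
    · rw [fderiv_collar_of_notMem hxt, norm_zero]; positivity
    by_cases h2 : 2 < g j x
    · rw [fderiv_collar_of_two_lt (hgc j x (hsubU hxt)) h2, norm_zero]; positivity
    have hFx : ‖F x‖ ≤ 2 * r j := by
      have : ‖F x‖ ^ 2 ≤ 2 * r j ^ 2 := by
        rw [not_lt, div_le_iff₀ (by positivity)] at h2
        exact h2
      refine abs_le_of_sq_le_sq' ?_ (by positivity) |>.2
      nlinarith [sq_nonneg (r j)]
    have hFd : HasFDerivAt F (fderiv ℝ F x) x :=
      ((hF.contDiffAt (hU.mem_nhds (hsubU hxt))).differentiableAt (by simp)).hasFDerivAt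
    have hgd : HasFDerivAt (g j) ((r j ^ 2)⁻¹ • (2 • (innerSL ℝ (F x)).comp (fderiv ℝ F x))) x := by
      have := hFd.norm_sq.const_mul ((r j ^ 2)⁻¹)
      refine this.congr_of_eventuallyEq (Eventually.of_forall fun y => ?_)
      simp only [g]; ring
    have hgn : ‖fderiv ℝ (g j) x‖ ≤ 4 * L / r j := by
      rw [hgd.fderiv, norm_smul, Real.norm_of_nonneg (by positivity)]
      have h3 : ‖(2 • (innerSL ℝ (F x)).comp (fderiv ℝ F x))‖ ≤ 2 * (2 * r j * L) := by
        rw [two_nsmul]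
        have h4 : ‖(innerSL ℝ (F x)).comp (fderiv ℝ F x)‖ ≤ 2 * r j * L := by
          refine (ContinuousLinearMap.opNorm_comp_le _ _).trans ?_
          rw [innerSL_apply_norm]
          exact mul_le_mul hFx (h x hxb).2.1.le (norm_nonneg _) (by positivity)
        refine (norm_add_le _ _).trans (by linarith)
      calc _ ≤ (r j ^ 2)⁻¹ * (2 * (2 * r j * L)) := by gcongr
        _ = _ := by field_simp; ring
    rw [fderiv_collar hχ hgd.differentiableAt, norm_neg]
    calc _ ≤ ‖(χ x * deriv cutoff (g j x)) • fderiv ℝ (g j) x‖ + ‖cutoff (g j x) • fderiv ℝ χ x‖ :=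
          norm_add_le _ _
      _ ≤ (1 * Cβ) * (4 * L / r j) + 1 * Cχ := by
          rw [norm_smul, norm_smul, norm_mul, Real.norm_of_nonneg (hχ01 x).1,
            Real.norm_of_nonneg (cutoff_nonneg _)]
          gcongr
          · exact (hχ01 x).2
          · exact hCβ _
          · exact cutoff_le_one _
          · exact hCχ x
      _ ≤ (1 * Cβ) * (4 * L / r j) + Cχ / r j := by
          rw [one_mul Cχ]
          gcongr
          exact le_div_self hCχ0 hrj (hr1 j)
      _ = D / r j := by rw [hD]; ring
  have ha₀ : ∀ x ∈ A ∩ ball p δ, a x * D ^ 2 ≤ |a₀| * D ^ 2 := fun x hx =>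
    mul_le_mul_of_nonneg_right ((h x hx.2).1.le.trans (le_abs_self _)) (by positivity)
  have henergy : ∀ j, ∫⁻ x in A, ENNReal.ofReal (a x * ‖fderiv ℝ (collar χ (g j)) x‖ ^ 2) ≤
      ENNReal.ofReal (4 * |a₀| * D ^ 2 * C) := by
    intro j
    have hrj := hr j
    refine (setLIntegral_ofReal_le hA (measurableSet_toMeasurable volume _) (S := S j)
      (C := |a₀| * D ^ 2 / r j ^ 2) (fun x hx _ => ?_) (fun x _ hxS => ?_)).trans ?_
    · by_cases hxb : x ∈ ball p δ
      · calc a x * ‖fderiv ℝ (collar χ (g j)) x‖ ^ 2 ≤ a x * (D / r j) ^ 2 := by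
              have := ha0 x hx
              have := hbound j x hxb
              gcongr
          _ = a x * D ^ 2 / r j ^ 2 := by ring
          _ ≤ _ := by gcongr ?_ / _; exact ha₀ x ⟨hx, hxb⟩
      · rw [fderiv_collar_of_notMem fun h' => hxb (hsub h')]
        have h9 : 0 ≤ |a₀| * D ^ 2 / r j ^ 2 := by positivity
        simpa using h9
    · rw [hzero j x hxS]; simp
    · refine (mul_le_mul_right (hS j) _).trans ?_
      rw [← ENNReal.ofReal_mul (by positivity)]
      refine ENNReal.ofReal_le_ofReal (le_of_eq ?_)
      field_simp
      ring
  have hSlim : Tendsto (fun j => volume (S j)) atTop (𝓝 0) := by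
    refine tendsto_of_tendsto_of_tendsto_of_le_of_le tendsto_const_nhds ?_ (fun _ => zero_le) hS
    have h5 : Tendsto r atTop (𝓝 0) := tendsto_one_div_add_atTop_nhds_zero_nat
    have h6 := ENNReal.tendsto_ofReal (((h5.const_mul 2).pow 2).const_mul C)
    simpa using h6
  have hlim : Tendsto (fun j => ∫⁻ x in A ∩ S j, ENNReal.ofReal (a x * ‖gradient v x‖ ^ 2))
      atTop (𝓝 0) := by
    have h7 : Tendsto (volume.restrict A ∘ S) atTop (𝓝 0) :=
      tendsto_of_tendsto_of_tendsto_of_le_of_le tendsto_const_nhds hSlim (fun _ => zero_le)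
        fun j => Measure.restrict_apply_le _ _
    have h8 := tendsto_setLIntegral_zero hfin h7
    refine h8.congr fun j => ?_
    rw [Measure.restrict_restrict (measurableSet_toMeasurable _ _), inter_comm]
  refine ⟨ball p (δ / 4), ball_mem_nhds _ (by linarith), fun ε hε => ?_⟩
  obtain ⟨j, hj⟩ := exists_fluxDefect_le ha ha0 hA (fun j => measurableSet_toMeasurable volume _)
    (fun j x _ => hzero j x) (by positivity) henergy hlim hε
  refine ⟨_, contDiff_collar hχ hU (hgU j) hsubU, collar_mem_Icc hχ01, fun x hx => ?_,
    fun x hx => collar_of_notMem fun h' => (h x (hsub h')).2.2.1 hx, hj⟩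
  refine collar_eventuallyEq_zero ?_ (hgc j x hx.2.1) (by simp [g, hx.2.2])
  filter_upwards [isOpen_ball.mem_nhds hx.1] with y hy using hχ1 y hy

end

/-! ### Neumann boundary points and the point at infinity -/

section


variable {n : ℕ} {a v : E n → ℝ} {A Q s t : Set (E n)}

/-- For the collar of thickness `2r` along `{ψ = 0}`, the defect density contains `⟨∇ψ, ∇v⟩ / r`
with a nonnegative bounded coefficient, so only an upper bound `w` on `⟨∇ψ, ∇v⟩` matters. The layer
has volume `O(r)`; the total is `O(w + r)`. -/
theorem exists_removable_nhds_neumann (ha0 : ∀ x ∈ A, 0 ≤ a x)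
    (hA : MeasurableSet A) {p : E n} (hac : ContinuousAt a p) (hQ : IsClosed Q) (hp : p ∉ Q)
    {U : Set (E n)} (hU : IsOpen U) (hpU : p ∈ U) {ψ : E n → ℝ} (hψ : ContDiffOn ℝ ∞ ψ U)
    (hψ' : fderiv ℝ ψ p ≠ 0) (hAψ : ∀ x ∈ A ∩ U, ψ x < 0) {B : ℝ}
    (hB : ∀ x ∈ A ∩ U, ‖gradient v x‖ ≤ B)
    (hsign : ∀ w > 0, ∃ r > 0, ∀ x ∈ A ∩ U, -r ≤ ψ x → fderiv ℝ ψ x (gradient v x) ≤ w) :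
    ∃ t ∈ 𝓝 p, Removable a v A Q (t ∩ {x ∈ U | 0 ≤ ψ x}) := by
  have hψp' : ContDiffAt ℝ ∞ ψ p := hψ.contDiffAt (hU.mem_nhds hpU)
  have hstrict : HasStrictFDerivAt ψ (fderiv ℝ ψ p) p := hψp'.hasStrictFDerivAt (by simp)
  have hstrict' : HasStrictFDerivAt (fun x (_ : Fin 1) => ψ x)
      (ContinuousLinearMap.pi fun _ => fderiv ℝ ψ p) p :=
    hasStrictFDerivAt_pi.2 fun _ => hstrict
  have hsurj : Function.Surjective
      (ContinuousLinearMap.pi fun _ : Fin 1 => fderiv ℝ ψ p) := by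
    intro y
    obtain ⟨u, hu⟩ : ∃ u, fderiv ℝ ψ p u ≠ 0 := by
      by_contra! hcon
      exact hψ' (ContinuousLinearMap.ext hcon)
    refine ⟨(y 0 / fderiv ℝ ψ p u) • u, ?_⟩
    ext i
    simp [Subsingleton.elim i 0, hu]
  obtain ⟨δ₁, hδ₁, C, hC0, hC⟩ := exists_measure_tube_le (volume : Measure (E n)) hstrict' hsurj
  set a₀ := |a p| + 1
  have hev1 : ∀ᶠ x in 𝓝 p, a x < a₀ :=
    hac.eventually_lt_const (by linarith [le_abs_self (a p)])
  have hev3 : ∀ᶠ x in 𝓝 p, x ∉ Q := hQ.isOpen_compl.mem_nhds hp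
  have hev4 : ∀ᶠ x in 𝓝 p, x ∈ U := hU.mem_nhds hpU
  have hev5 : ∀ᶠ x in 𝓝 p, x ∈ ball p δ₁ := ball_mem_nhds p hδ₁
  obtain ⟨δ, hδ, h⟩ := Metric.eventually_nhds_iff_ball.1 (hev1.and (hev3.and (hev4.and hev5)))
  obtain ⟨χ, hχ, hχ01, hχ1, hχs⟩ := exists_bump p hδ
  have hsub : tsupport χ ⊆ ball p δ := hχs.trans (closedBall_subset_ball (by linarith))
  have hsubU : tsupport χ ⊆ U := fun x hx => (h x (hsub hx)).2.2.1
  obtain ⟨Cχ, hCχ⟩ : ∃ Cχ, ∀ x, ‖fderiv ℝ χ x‖ ≤ Cχ :=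
    (hχ.continuous_fderiv (by simp)).bounded_above_of_compact_support
      ((HasCompactSupport.of_support_subset_isCompact (isCompact_closedBall p (δ / 2))
        ((subset_tsupport χ).trans hχs)).fderiv ℝ)
  have hCχ0 : 0 ≤ Cχ := (norm_nonneg _).trans (hCχ p)
  obtain ⟨Cβ, hCβ0, hCβ⟩ := exists_deriv_cutoff_bound
  refine ⟨ball p (δ / 4), ball_mem_nhds _ (by linarith), fun ε hε => ?_⟩
  -- Chosen so that `w = ε / D` and `r ≤ ε / D` bound the defect by `(D - 1) ε / D`; the summand `1`
  -- keeps `D` positive.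
  set D := a₀ * (Cβ + Cχ * |B|) * (2 * C) + 1 with hD
  have hD0 : 0 < D := by positivity
  obtain ⟨r₀, hr₀, hsign⟩ := hsign (ε / D) (by positivity)
  set r := min (r₀ / 2) (ε / D) with hrdef
  have hr : 0 < r := by positivity
  have hr2 : 2 * r ≤ r₀ := by linarith [min_le_left (r₀ / 2) (ε / D)]
  have hr3 : r ≤ ε / D := min_le_right _ _
  let g : E n → ℝ := fun x => -ψ x / r
  have hgU : ContDiffOn ℝ ∞ g U := hψ.neg.div_const _
  have hgc : ∀ x ∈ U, ContinuousAt g x := fun x hx =>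
    (hgU.contDiffAt (hU.mem_nhds hx)).continuousAt
  let S : Set (E n) := toMeasurable volume
    {x ∈ ball p δ₁ | ‖(fun _ => ψ x : Fin 1 → ℝ)‖ ≤ 2 * r}
  have hS : volume S ≤ ENNReal.ofReal (C * (2 * r) ^ 1) := by
    rw [measure_toMeasurable]; exact hC _ (by positivity)
  have hzero : ∀ x ∈ A, x ∉ S → fderiv ℝ (collar χ g) x = 0 := by
    intro x hxA hx
    by_cases hxt : x ∈ tsupport χ
    · refine fderiv_collar_of_two_lt (hgc x (hsubU hxt)) ?_
      by_contra hcon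
      refine hx (subset_toMeasurable _ _ ⟨(h x (hsub hxt)).2.2.2, ?_⟩)
      rw [not_lt, div_le_iff₀ hr] at hcon
      refine (pi_norm_le_iff_of_nonneg (by positivity)).2 fun _ => ?_
      have := hAψ x ⟨hxA, hsubU hxt⟩
      rw [Real.norm_eq_abs, abs_of_neg this]
      exact hcon
    · exact fderiv_collar_of_notMem hxt
  have hbound : ∀ x ∈ A, -(a x * fderiv ℝ (collar χ g) x (gradient v x)) ≤
      a₀ * (Cβ / r * (ε / D) + Cχ * |B|) := by
    intro x hxA
    by_cases hxt : x ∈ tsupport χ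
    swap
    · rw [fderiv_collar_of_notMem hxt]
      simp only [zero_apply, mul_zero, neg_zero]
      positivity
    by_cases h2 : 2 < g x
    · rw [fderiv_collar_of_two_lt (hgc x (hsubU hxt)) h2]
      simp only [zero_apply, mul_zero, neg_zero]
      positivity
    have hxU := hsubU hxt
    have hψd : HasFDerivAt ψ (fderiv ℝ ψ x) x :=
      ((hψ.contDiffAt (hU.mem_nhds hxU)).differentiableAt (by simp)).hasFDerivAt
    have hgd : HasFDerivAt g (-(r⁻¹ • fderiv ℝ ψ x)) x := by
      have := (hψd.const_mul r⁻¹).neg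
      refine this.congr_of_eventuallyEq (Eventually.of_forall fun y => ?_)
      simp only [g, Pi.neg_apply]; ring
    have hw : fderiv ℝ ψ x (gradient v x) ≤ ε / D := by
      refine hsign x ⟨hxA, hxU⟩ ?_
      rw [not_lt, div_le_iff₀ hr] at h2
      linarith
    have hχv : fderiv ℝ χ x (gradient v x) ≤ Cχ * |B| :=
      (le_abs_self _).trans (((fderiv ℝ χ x).le_opNorm _).trans
        (mul_le_mul (hCχ x) ((hB x ⟨hxA, hxU⟩).trans (le_abs_self _)) (norm_nonneg _) hCχ0))
    rw [fderiv_collar hχ hgd.differentiableAt, hgd.fderiv]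
    simp only [neg_apply, add_apply, smul_apply, smul_eq_mul]
    have hb := deriv_cutoff_nonpos (g x)
    have hb' : -deriv cutoff (g x) ≤ Cβ := (neg_le_abs _).trans (hCβ _)
    have h1 : χ x * (-deriv cutoff (g x)) * (r⁻¹ * fderiv ℝ ψ x (gradient v x)) ≤
        Cβ / r * (ε / D) := by
      have hm0 : 0 ≤ χ x * (-deriv cutoff (g x)) := mul_nonneg (hχ01 x).1 (by linarith)
      have hm1 : χ x * (-deriv cutoff (g x)) ≤ Cβ := by
        calc _ ≤ 1 * (-deriv cutoff (g x)) :=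
              mul_le_mul_of_nonneg_right (hχ01 x).2 (by linarith)
          _ ≤ _ := by linarith
      calc _ ≤ χ x * (-deriv cutoff (g x)) * (r⁻¹ * (ε / D)) := by gcongr
        _ ≤ Cβ * (r⁻¹ * (ε / D)) := by gcongr
        _ = _ := by ring
    have h3 : cutoff (g x) * fderiv ℝ χ x (gradient v x) ≤ Cχ * |B| :=
      (mul_le_mul_of_nonneg_left hχv (cutoff_nonneg _)).trans
        (mul_le_of_le_one_left (by positivity) (cutoff_le_one _))
    have h4 : 0 ≤ Cβ / r * (ε / D) + Cχ * |B| := by positivity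
    calc _ = a x * (χ x * (-deriv cutoff (g x)) * (r⁻¹ * fderiv ℝ ψ x (gradient v x)) +
          cutoff (g x) * fderiv ℝ χ x (gradient v x)) := by ring
      _ ≤ a x * (Cβ / r * (ε / D) + Cχ * |B|) :=
          mul_le_mul_of_nonneg_left (add_le_add h1 h3) (ha0 x hxA)
      _ ≤ _ := mul_le_mul_of_nonneg_right (h x (hsub hxt)).1.le h4
  refine ⟨_, contDiff_collar hχ hU hgU hsubU, collar_mem_Icc hχ01, fun x hx => ?_,
    fun x hx => collar_of_notMem fun h' => (h x (hsub h')).2.1 hx, ?_⟩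
  · refine collar_eventuallyEq_zero ?_ (hgc x hx.2.1) ?_
    · filter_upwards [isOpen_ball.mem_nhds hx.1] with y hy using hχ1 y hy
    · have : g x ≤ 0 := div_nonpos_of_nonpos_of_nonneg (by linarith [hx.2.2]) hr.le
      linarith
  · refine (setLIntegral_ofReal_le hA (measurableSet_toMeasurable volume _)
      (fun x hx _ => hbound x hx) fun x hx hxS => ?_).trans
      ((mul_le_mul_right hS _).trans ?_)
    · rw [hzero x hx hxS]; simp
    · rw [← ENNReal.ofReal_mul (by positivity)]
      refine ENNReal.ofReal_le_ofReal ?_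
      calc _ = a₀ * (Cβ * (ε / D) + Cχ * |B| * r) * (2 * C) := by field_simp
        _ ≤ a₀ * (Cβ * (ε / D) + Cχ * |B| * (ε / D)) * (2 * C) := by gcongr
        _ = (D - 1) * (ε / D) := by rw [hD]; ring
        _ ≤ D * (ε / D) := by gcongr; linarith
        _ = ε := by field_simp

/-- For `K = 1` the set `Ω` may accumulate at the antipode, which is infinity in the chart. On `R ≤
|x| ≤ 2R` the weight is `O(R^(2-n))`, the squared gradient of the cutoff `O(R⁻²)` and the volume
`O(Rⁿ)`, so the energy is bounded, while the energy of `v` on `{|x| ≥ R}` tends to zero. -/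
theorem exists_compactSupport_cutoff (hn : 2 ≤ n) (ha : Measurable a) (ha0 : ∀ x ∈ A, 0 ≤ a x)
    (hA : MeasurableSet A) (hfin : ∫⁻ x in A, ENNReal.ofReal (a x * ‖gradient v x‖ ^ 2) ≠ ⊤)
    (hQ : Bornology.IsBounded Q) {C₀ : ℝ} (hC₀ : 0 ≤ C₀)
    (hdecay : ∀ x ∈ A, a x * ‖x‖ ^ (n - 2) ≤ C₀) {ε : ℝ} (hε : 0 < ε) :
    ∃ η : E n → ℝ, ContDiff ℝ 1 η ∧ (∀ x, η x ∈ Icc (0 : ℝ) 1) ∧ HasCompactSupport η ∧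
      (∀ x ∈ Q, η x = 1) ∧ fluxDefect a v A η ≤ ENNReal.ofReal ε := by
  obtain ⟨Cβ, hCβ0, hCβ⟩ := exists_deriv_cutoff_bound
  obtain ⟨R₀, hR₀⟩ := hQ.subset_closedBall 0
  let R : ℕ → ℝ := fun j => j + (1 + |R₀|)
  have hR1 : ∀ j, 1 ≤ R j := fun j => by
    have : (0 : ℝ) ≤ j := Nat.cast_nonneg j
    have := abs_nonneg R₀
    simp only [R]; linarith
  have hR : ∀ j, 0 < R j := fun j => one_pos.trans_le (hR1 j)
  let g : ℕ → E n → ℝ := fun j x => (R j ^ 2)⁻¹ * ‖x‖ ^ 2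
  let η : ℕ → E n → ℝ := fun j x => cutoff (g j x)
  let S : ℕ → Set (E n) := fun j => {x | R j ≤ ‖x‖}
  have hSm : ∀ j, MeasurableSet (S j) := fun j => measurableSet_le measurable_const measurable_norm
  have hg : ∀ j, ContDiff ℝ 1 (g j) := fun j => contDiff_const.mul (contDiff_norm_sq ℝ)
  have hη : ∀ j, ContDiff ℝ 1 (η j) := fun j => (contDiff_cutoff (m := 1)).comp (hg j)
  have hone : ∀ j x, ‖x‖ ≤ R j → η j x = 1 := fun j x hx => by
    refine cutoff_of_le ?_
    simp only [g]
    rw [inv_mul_le_iff₀ (by have := hR j; positivity), mul_one]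
    gcongr
  have hvan : ∀ j x, 2 * R j ≤ ‖x‖ → η j x = 0 := fun j x hx => by
    refine cutoff_of_ge ?_
    have hRj := hR j
    simp only [g]
    rw [le_inv_mul_iff₀ (by positivity)]
    nlinarith
  have hzero : ∀ j, ∀ x ∈ A, x ∉ S j → fderiv ℝ (η j) x = 0 := by
    intro j x _ hx
    have : η j =ᶠ[𝓝 x] fun _ => 1 := by
      filter_upwards [(continuous_norm.tendsto x).eventually_lt_const (not_le.1 hx)] with y hy
      exact hone j y hy.le
    rw [this.fderiv_eq]; simp
  have hzero' : ∀ j x, x ∉ closedBall (0 : E n) (2 * R j) → fderiv ℝ (η j) x = 0 := by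
    intro j x hx
    rw [mem_closedBall_zero_iff, not_le] at hx
    have : η j =ᶠ[𝓝 x] fun _ => 0 := by
      filter_upwards [(continuous_norm.tendsto x).eventually_const_lt hx] with y hy
      exact hvan j y hy.le
    rw [this.fderiv_eq]; simp
  have hbound : ∀ j, ∀ x ∈ closedBall (0 : E n) (2 * R j), ‖fderiv ℝ (η j) x‖ ≤ 4 * Cβ / R j := by
    intro j x hx
    have hRj := hR j
    rw [mem_closedBall_zero_iff] at hx
    have hgd : HasFDerivAt (g j) ((R j ^ 2)⁻¹ • (2 • innerSL ℝ x)) x :=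
      ((hasStrictFDerivAt_norm_sq x).hasFDerivAt).const_mul _
    have hd : HasFDerivAt (η j) (deriv cutoff (g j x) • ((R j ^ 2)⁻¹ • (2 • innerSL ℝ x))) x :=
      (differentiable_cutoff (g j x)).hasDerivAt.comp_hasFDerivAt x hgd
    rw [hd.fderiv, norm_smul, norm_smul, Real.norm_of_nonneg (by positivity : 0 ≤ (R j ^ 2)⁻¹),
      two_nsmul]
    have h1 : ‖innerSL ℝ x + innerSL ℝ x‖ ≤ 4 * R j := by
      refine (norm_add_le _ _).trans ?_
      rw [innerSL_apply_norm]; linarith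
    calc _ ≤ Cβ * ((R j ^ 2)⁻¹ * (4 * R j)) := by
          gcongr
          exact hCβ _
      _ = _ := by field_simp
  have henergy : ∀ j, ∫⁻ x in A, ENNReal.ofReal (a x * ‖fderiv ℝ (η j) x‖ ^ 2) ≤
      ENNReal.ofReal (C₀ * (4 * Cβ) ^ 2 * 2 ^ n * (volume (ball (0 : E n) 1)).toReal) := by
    intro j
    have hRj := hR j
    refine (setLIntegral_ofReal_le hA (hSm j |>.inter (measurableSet_closedBall (x := (0 : E n))
      (ε := 2 * R j))) (C := C₀ / R j ^ (n - 2) * (4 * Cβ / R j) ^ 2) (fun x hx hxS => ?_)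
      (fun x hx hxS => ?_)).trans ?_
    · have h1 : a x ≤ C₀ / R j ^ (n - 2) := by
        rw [le_div_iff₀ (by positivity)]
        have h2 : R j ≤ ‖x‖ := hxS.1
        refine le_trans ?_ (hdecay x hx)
        have := ha0 x hx
        gcongr
      have := ha0 x hx
      have := hbound j x hxS.2
      gcongr
    · have : fderiv ℝ (η j) x = 0 := by
        by_cases hx1 : x ∈ S j
        · exact hzero' j x fun h => hxS ⟨hx1, h⟩
        · exact hzero j x hx hx1
      rw [this]; simp
    · refine (mul_le_mul_right (measure_mono inter_subset_right) _).trans ?_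
      rw [Measure.addHaar_closedBall _ _ (by positivity), finrank_euclideanSpace_fin,
        ← ENNReal.ofReal_toReal (measure_ball_lt_top (x := (0 : E n)) (r := 1) (μ := volume)).ne,
        ← ENNReal.ofReal_mul (by positivity), ← ENNReal.ofReal_mul (by positivity)]
      refine ENNReal.ofReal_le_ofReal (le_of_eq ?_)
      rw [ENNReal.toReal_ofReal ENNReal.toReal_nonneg]
      obtain ⟨m, rfl⟩ := Nat.exists_eq_add_of_le' hn
      simp only [Nat.add_sub_cancel]
      field_simp
      rw [mul_pow]
      ring
  have hlim : Tendsto (fun j => ∫⁻ x in A ∩ S j, ENNReal.ofReal (a x * ‖gradient v x‖ ^ 2))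
      atTop (𝓝 0) := by
    set f : E n → ℝ≥0∞ := fun x => ENNReal.ofReal (a x * ‖gradient v x‖ ^ 2)
    have hanti : Antitone S := fun i j hij x hx => by
      have h1 : R j ≤ ‖x‖ := hx
      have h2 : (i : ℝ) ≤ j := by exact_mod_cast hij
      show R i ≤ ‖x‖
      simp only [R] at h1 ⊢
      linarith
    have hinter : ⋂ j, S j = ∅ := by
      refine eq_empty_of_forall_notMem fun x hx => ?_
      obtain ⟨j, hj⟩ := exists_nat_gt ‖x‖
      have h1 : R j ≤ ‖x‖ := mem_iInter.1 hx j
      simp only [R] at h1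
      linarith [abs_nonneg R₀]
    have hm := tendsto_measure_iInter_atTop (μ := (volume.restrict A).withDensity f) (s := S)
      (fun j => (hSm j).nullMeasurableSet) hanti ⟨0, ne_top_of_le_ne_top hfin (by
        rw [withDensity_apply _ (hSm 0)]; exact setLIntegral_le_lintegral _ _)⟩
    rw [hinter, measure_empty] at hm
    refine hm.congr fun j => ?_
    rw [Function.comp_apply, withDensity_apply _ (hSm j), Measure.restrict_restrict (hSm j),
      inter_comm]
  obtain ⟨j, hj⟩ := exists_fluxDefect_le ha ha0 hA hSm hzero (by positivity) henergy hlim hε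
  refine ⟨η j, hη j, fun x => ⟨cutoff_nonneg _, cutoff_le_one _⟩, ?_, fun x hx => hone j x ?_, hj⟩
  · refine HasCompactSupport.of_support_subset_isCompact (isCompact_closedBall 0 (2 * R j)) ?_
    intro x hx
    rw [mem_closedBall_zero_iff]
    by_contra hcon
    exact hx (hvan j x (not_le.1 hcon).le)
  · have h1 : ‖x‖ ≤ R₀ := by simpa using hR₀ hx
    have : (0 : ℝ) ≤ j := Nat.cast_nonneg j
    simp only [R]
    linarith [le_abs_self R₀]

end

/-! ### The energy inequality -/

section


variable {n : ℕ} {a v : E n → ℝ} {A Q s t D : Set (E n)}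

theorem gradient_apply (v : E n → ℝ) (x : E n) (i : Fin n) :
    gradient v x i = fderiv ℝ v x (EuclideanSpace.single i 1) := by
  have h : inner ℝ (gradient v x) (EuclideanSpace.single i (1 : ℝ)) =
      fderiv ℝ v x (EuclideanSpace.single i 1) := InnerProductSpace.toDual_symm_apply
  rw [← h, EuclideanSpace.inner_single_right]; simp

theorem fderiv_apply_gradient (φ v : E n → ℝ) (x : E n) :
    fderiv ℝ φ x (gradient v x) = ∑ i, fderiv ℝ v x (EuclideanSpace.single i 1) *
      fderiv ℝ φ x (EuclideanSpace.single i 1) := by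
  conv_lhs => rw [← (EuclideanSpace.basisFun (Fin n) ℝ).sum_repr (gradient v x)]
  simp [map_sum, gradient_apply]

theorem norm_gradient_sq (v : E n → ℝ) (x : E n) :
    ‖gradient v x‖ ^ 2 = ∑ i, fderiv ℝ v x (EuclideanSpace.single i 1) ^ 2 := by
  rw [EuclideanSpace.norm_sq_eq]
  simp [gradient_apply]

theorem fderiv_apply_gradient_self (v : E n → ℝ) (x : E n) :
    fderiv ℝ v x (gradient v x) = ‖gradient v x‖ ^ 2 := by
  rw [fderiv_apply_gradient, norm_gradient_sq]; simp [sq]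

/-! ### Integration by parts, weak derivatives and the tested inequality. -/

theorem integrable_mul_of_tsupport_subset (hD : IsOpen D) {f g : E n → ℝ} (hf : ContinuousOn f D)
    (hg : Continuous g) (hgc : HasCompactSupport g) (hgs : tsupport g ⊆ D) :
    Integrable fun x => f x * g x := by
  refine Continuous.integrable_of_hasCompactSupport ?_ hgc.mul_left
  exact (hf.mul hg.continuousOn).continuous_of_tsupport_subset hD
    ((tsupport_mul_subset_right (f := f) (g := g)).trans hgs)

theorem integral_mul_fderiv_eq_neg (hD : IsOpen D) {f g : E n → ℝ} (hf : ContDiffOn ℝ 1 f D)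
    (hg : ContDiff ℝ 1 g) (hgc : HasCompactSupport g) (hgs : tsupport g ⊆ D) (e : E n) :
    Integrable (fun x => f x * fderiv ℝ g x e) ∧ Integrable (fun x => fderiv ℝ f x e * g x) ∧
      ∫ x, f x * fderiv ℝ g x e = -∫ x, fderiv ℝ f x e * g x := by
  have hg' : Continuous fun x => fderiv ℝ g x e :=
    (hg.continuous_fderiv (by norm_num)).clm_apply continuous_const
  have hf' : ContinuousOn (fun x => fderiv ℝ f x e) D :=
    (hf.continuousOn_fderiv_of_isOpen hD (by norm_num)).clm_apply continuousOn_const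
  have h1 := integrable_mul_of_tsupport_subset hD hf.continuousOn hg' (hgc.fderiv_apply ℝ e)
    ((tsupport_fderiv_apply_subset ℝ e).trans hgs)
  have h2 := integrable_mul_of_tsupport_subset hD hf' hg.continuous hgc hgs
  have h3 := integrable_mul_of_tsupport_subset hD hf.continuousOn hg.continuous hgc hgs
  refine ⟨h1, h2, integral_mul_fderiv_eq_neg_fderiv_mul_of_integrable h2 h1 h3 (fun x hx => ?_)
    fun x _ => hg.differentiable (by norm_num) x⟩
  exact (hf.contDiffAt (hD.mem_nhds (hgs hx))).differentiableAt (by norm_num)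

/-- The fundamental lemma of the calculus of variations. It turns the `W^{1,2}` hypothesis into a
bound on the classical gradient. -/
theorem IsWeakPartial.ae_eq_fderiv (hD : IsOpen D) (hv : ContDiffOn ℝ 1 v D) {i : Fin n}
    {w : E n → ℝ} (hw : IsWeakPartial D i v w) :
    ∀ᵐ x, x ∈ D → w x = fderiv ℝ v x (EuclideanSpace.single i 1) := by
  obtain ⟨-, hwl, hw⟩ := hw
  set e : E n := EuclideanSpace.single i 1
  have hv' : ContinuousOn (fun x => fderiv ℝ v x e) D :=
    (hv.continuousOn_fderiv_of_isOpen hD (by norm_num)).clm_apply continuousOn_const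
  have hl : LocallyIntegrableOn (fun x => w x - fderiv ℝ v x e) D :=
    hwl.sub (hv'.locallyIntegrableOn hD.measurableSet)
  have h := IsOpen.ae_eq_zero_of_integral_contDiff_smul_eq_zero hD hl fun φ hφ hφc hφD => ?_
  · filter_upwards [h] with x hx hxD using sub_eq_zero.1 (hx hxD)
  obtain ⟨-, h2, h3⟩ := integral_mul_fderiv_eq_neg hD hv (hφ.of_le (by simp)) hφc hφD e
  have hsupp : ∀ x, x ∉ D → φ x = 0 := fun x hx =>
    image_eq_zero_of_notMem_tsupport fun h => hx (hφD h)
  have hsupp' : ∀ x, x ∉ D → fderiv ℝ φ x e = 0 := fun x hx => by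
    rw [fderiv_of_notMem_tsupport ℝ fun h => hx (hφD h)]; simp
  have hwφ : Integrable fun x => w x * φ x := by
    have h4 : IntegrableOn (fun x => w x * φ x) (tsupport φ) :=
      (hwl.integrableOn_compact_subset hφD hφc).mul_continuousOn hφ.continuous.continuousOn hφc
    refine (integrableOn_iff_integrable_of_support_subset ?_).1 h4
    exact (Function.support_mul_subset_right _ _).trans (subset_tsupport φ)
  have h5 := hw φ hφ hφc hφD
  rw [setIntegral_eq_integral_of_forall_compl_eq_zero fun x hx => by simp [hsupp' x hx],
    setIntegral_eq_integral_of_forall_compl_eq_zero fun x hx => by simp [hsupp x hx], h3,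
    neg_inj] at h5
  calc ∫ x, φ x • (w x - fderiv ℝ v x e) = ∫ x, (w x * φ x - fderiv ℝ v x e * φ x) := by
        congr 1; ext x; rw [smul_eq_mul]; ring
    _ = 0 := by rw [integral_sub hwφ h2, h5, sub_self]

theorem measurable_conf (K : ℝ) : Measurable (conf K : E n → ℝ) := by
  unfold conf; fun_prop

theorem conf_pos {K : ℝ} {x : E n} (hx : x ∈ M n K) : 0 < conf K x := inv_pos.2 hx

theorem contDiffOn_conf (K : ℝ) : ContDiffOn ℝ ∞ (conf K) (M n K) := by
  refine ContDiffOn.inv ?_ fun x hx => ne_of_gt hx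
  exact (contDiff_const.add (contDiff_const.mul (contDiff_norm_sq ℝ))).contDiffOn

theorem isOpen_M (n : ℕ) (K : ℝ) : IsOpen (M n K) :=
  isOpen_lt continuous_const (by fun_prop)

/-- The factor `conf⁻²` from `|∇v|_g²` and the factor `confⁿ` from the volume combine to the weight
`conf^(n-2)` of the divergence form. -/
theorem lintegral_gradient_sq_ne_top (hn : 2 ≤ n) {K : ℝ} (hD : IsOpen D) (hDM : D ⊆ M n K)
    (hv : ContDiffOn ℝ 1 v D) (hvW : MemW12 K D v) :
    ∫⁻ x in D, ENNReal.ofReal (conf K x ^ (n - 2) * ‖gradient v x‖ ^ 2) ≠ ⊤ := by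
  obtain ⟨-, w, hw⟩ := hvW
  have hcm : Measurable fun x : E n => ENNReal.ofReal (conf K x ^ n) :=
    ((measurable_conf K).pow_const n).ennreal_ofReal
  have hi : ∀ i, ∫⁻ x in D, ENNReal.ofReal (conf K x ^ (n - 2) *
      fderiv ℝ v x (EuclideanSpace.single i 1) ^ 2) ≠ ⊤ := by
    intro i
    have h1 := (hw i).2.eLpNorm_lt_top
    rw [eLpNorm_lt_top_iff_lintegral_rpow_enorm_lt_top (by norm_num) (by norm_num), vol,
      restrict_withDensity hD.measurableSet,
      lintegral_withDensity_eq_lintegral_mul_non_measurable _ hcm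
        (Eventually.of_forall fun _ => ENNReal.ofReal_lt_top)] at h1
    refine ne_of_lt (lt_of_le_of_lt (le_of_eq ?_) h1)
    refine lintegral_congr_ae ?_
    filter_upwards [ae_restrict_mem hD.measurableSet,
      ae_restrict_of_ae ((hw i).1.ae_eq_fderiv hD hv)] with x hxD hx
    have hc := conf_pos (hDM hxD)
    rw [← hx hxD]
    simp only [Pi.mul_apply, ENNReal.toReal_ofNat, ENNReal.rpow_ofNat]
    rw [← ofReal_norm, ← ENNReal.ofReal_pow (norm_nonneg _),
      ← ENNReal.ofReal_mul (by positivity), Real.norm_eq_abs, sq_abs]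
    congr 1
    obtain ⟨m, rfl⟩ := Nat.exists_eq_add_of_le' hn
    simp only [Nat.add_sub_cancel]
    field_simp
    ring
  have : ∫⁻ x in D, ENNReal.ofReal (conf K x ^ (n - 2) * ‖gradient v x‖ ^ 2) =
      ∑ i, ∫⁻ x in D, ENNReal.ofReal (conf K x ^ (n - 2) *
        fderiv ℝ v x (EuclideanSpace.single i 1) ^ 2) := by
    rw [← lintegral_finsetSum]
    · refine setLIntegral_congr_fun hD.measurableSet fun x hx => ?_
      have hc := conf_pos (hDM hx)
      rw [norm_gradient_sq, Finset.mul_sum, ENNReal.ofReal_sum_of_nonneg]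
      intro i _
      positivity
    · intro i _
      exact (((measurable_conf K).pow_const _).mul
        ((measurable_fderiv_apply_const ℝ v _).pow_const 2)).ennreal_ofReal
  rw [this]
  exact ENNReal.sum_ne_top.2 fun i _ => hi i

/-- `v` satisfies `div (a ∇v) ≥ 0` in `D`. -/
def IsSubsolution (a v : E n → ℝ) (D : Set (E n)) : Prop :=
  ∀ x ∈ D, 0 ≤ ∑ i, fderiv ℝ (fun y => a y * fderiv ℝ v y (EuclideanSpace.single i 1)) x
    (EuclideanSpace.single i 1)

theorem IsSubsolution.integral_le_zero (h : IsSubsolution a v D) (hD : IsOpen D)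
    (ha : ContDiffOn ℝ 1 a D) (hv : ContDiffOn ℝ 2 v D) {φ : E n → ℝ} (hφ : ContDiff ℝ 1 φ)
    (hφ0 : ∀ x, 0 ≤ φ x) (hφc : HasCompactSupport φ) (hφD : tsupport φ ⊆ D) :
    Integrable (fun x => a x * fderiv ℝ φ x (gradient v x)) ∧
      ∫ x, a x * fderiv ℝ φ x (gradient v x) ≤ 0 := by
  have hi := fun i : Fin n => integral_mul_fderiv_eq_neg hD
    (ha.mul ((hv.fderiv_of_isOpen hD (m := 1) (by norm_num)).clm_apply
      (contDiffOn_const (c := EuclideanSpace.single i (1 : ℝ)))))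
    hφ hφc hφD (EuclideanSpace.single i 1)
  have heq : (fun x => a x * fderiv ℝ φ x (gradient v x)) = fun x => ∑ i : Fin n,
      a x * fderiv ℝ v x (EuclideanSpace.single i 1) *
        fderiv ℝ φ x (EuclideanSpace.single i 1) := by
    ext x
    rw [fderiv_apply_gradient, Finset.mul_sum]
    simp only [mul_assoc]
  rw [heq]
  refine ⟨integrable_finsetSum _ fun i _ => (hi i).1, ?_⟩
  rw [integral_finsetSum _ fun i _ => (hi i).1, Finset.sum_congr rfl fun i _ => (hi i).2.2,
    Finset.sum_neg_distrib, ← integral_finsetSum _ fun i _ => (hi i).2.1, neg_nonpos]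
  refine integral_nonneg fun x => ?_
  rw [Pi.zero_apply, ← Finset.sum_mul]
  by_cases hx : x ∈ D
  · exact mul_nonneg (h x hx) (hφ0 x)
  · rw [image_eq_zero_of_notMem_tsupport fun h' => hx (hφD h'), mul_zero]

theorem hasDerivAt_expNegInvGlue (x : ℝ) :
    HasDerivAt expNegInvGlue (x⁻¹ ^ 2 * expNegInvGlue x) x := by
  simpa using expNegInvGlue.hasDerivAt_polynomial_eval_inv_mul 1 x

theorem expNegInvGlue_le_one (x : ℝ) : expNegInvGlue x ≤ 1 := by
  rcases le_or_gt x 0 with hx | hx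
  · rw [expNegInvGlue.zero_of_nonpos hx]; exact zero_le_one
  · rw [expNegInvGlue, if_neg (not_le.2 hx)]
    exact Real.exp_le_one_iff.2 (by simpa using hx.le)

/-- The tested inequality for `G(v - c) η`, with `G = expNegInvGlue` as a smooth bounded substitute
for the positive part: `G ≤ 1` removes it from the flux term, and `G = 0` on `(-∞, 0]` confines that
term to `{v > c}`. -/
theorem IsSubsolution.lintegral_le_fluxDefect (h : IsSubsolution a v D) (hD : IsOpen D)
    (ha : ContDiffOn ℝ 1 a D) (ha0 : ∀ x ∈ D, 0 ≤ a x)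
    (hv : ContDiffOn ℝ 2 v D) (c : ℝ) {η : E n → ℝ} (hη : ContDiff ℝ 1 η)
    (hη01 : ∀ x, η x ∈ Icc (0 : ℝ) 1) (hηc : HasCompactSupport η)
    (hηD : ∀ x ∈ frontier D, η =ᶠ[𝓝 x] fun _ => 0) (hQ : MeasurableSet Q) (hQD : Q ⊆ D)
    (hηQ : ∀ x ∈ Q, η x = 1) :
    ∫⁻ x in Q, ENNReal.ofReal (a x * ((v x - c)⁻¹ ^ 2 * expNegInvGlue (v x - c)) *
      ‖gradient v x‖ ^ 2) ≤ fluxDefect a v {x ∈ D | c < v x} η := by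
  -- Extension by zero is `C¹` and supported in `D` because `η` vanishes near every frontier point
  -- of `D`.
  set φ : E n → ℝ := D.indicator fun x => expNegInvGlue (v x - c) * η x with hφdef
  have hφD : tsupport φ ⊆ D := by
    intro x hx
    by_contra hxD
    have hxc : x ∈ closure D := closure_mono support_indicator_subset hx
    refine notMem_tsupport_iff_eventuallyEq.2 ?_ hx
    filter_upwards [hηD x ⟨hxc, by rwa [hD.interior_eq]⟩] with y hy
    by_cases hyD : y ∈ D <;> simp [hφdef, hyD, hy]
  have hφc : HasCompactSupport φ := by
    refine hηc.mono fun x hx => ?_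
    rw [Function.mem_support] at hx ⊢
    contrapose! hx
    by_cases hxD : x ∈ D <;> simp [hφdef, hxD, hx]
  have hφ0 : ∀ x, 0 ≤ φ x := fun x => indicator_nonneg
    (fun y _ => mul_nonneg (expNegInvGlue.nonneg _) (hη01 y).1) x
  have hloc : ∀ x ∈ D, φ =ᶠ[𝓝 x] fun x => expNegInvGlue (v x - c) * η x := fun x hx => by
    filter_upwards [hD.mem_nhds hx] with y hy using indicator_of_mem hy _
  have hφ : ContDiff ℝ 1 φ := by
    refine contDiff_iff_contDiffAt.2 fun x => ?_
    by_cases hx : x ∈ tsupport φ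
    · have hxD := hφD hx
      have h1 : ContDiffAt ℝ 1 v x := (hv.contDiffAt (hD.mem_nhds hxD)).of_le (by norm_num)
      have h2 : ContDiff ℝ 1 expNegInvGlue := expNegInvGlue.contDiff (n := 1)
      exact ((h2.contDiffAt.comp x (h1.sub contDiffAt_const)).mul
        hη.contDiffAt).congr_of_eventuallyEq (hloc x hxD)
    · exact contDiffAt_const.congr_of_eventuallyEq (notMem_tsupport_iff_eventuallyEq.1 hx)
  obtain ⟨hint, hle⟩ := h.integral_le_zero hD ha hv hφ hφ0 hφc hφD
  set I : E n → ℝ := fun x => a x * fderiv ℝ φ x (gradient v x) with hI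
  set f : E n → ℝ := fun x =>
    a x * ((v x - c)⁻¹ ^ 2 * expNegInvGlue (v x - c)) * ‖gradient v x‖ ^ 2 with hf
  have hderiv : ∀ x ∈ D, I x = f x * η x +
      expNegInvGlue (v x - c) * (a x * fderiv ℝ η x (gradient v x)) := by
    intro x hx
    have h1 : HasFDerivAt (fun y => v y - c) (fderiv ℝ v x) x :=
      (((hv.contDiffAt (hD.mem_nhds hx)).differentiableAt (by norm_num)).hasFDerivAt).sub_const c
    have h2 : HasFDerivAt (fun y => expNegInvGlue (v y - c))
        (((v x - c)⁻¹ ^ 2 * expNegInvGlue (v x - c)) • fderiv ℝ v x) x :=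
      HasDerivAt.comp_hasFDerivAt (f := fun y => v y - c) x (hasDerivAt_expNegInvGlue _) h1
    have h3 := (h2.mul (hη.differentiable (by norm_num) x).hasFDerivAt).congr_of_eventuallyEq
      (hloc x hx)
    simp only [hI, hf, h3.fderiv, add_apply, smul_apply, smul_eq_mul, fderiv_apply_gradient_self]
    ring
  have hparts : ∫⁻ x, ENNReal.ofReal (I x) ≤ ∫⁻ x, ENNReal.ofReal (-I x) := by
    rw [integral_eq_lintegral_pos_part_sub_lintegral_neg_part hint, sub_nonpos] at hle
    exact (ENNReal.toReal_le_toReal hint.lintegral_lt_top.ne hint.neg.lintegral_lt_top.ne).1 hle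
  set A := {x ∈ D | c < v x} with hA
  have hAm : MeasurableSet A :=
    (hv.continuousOn.isOpen_inter_preimage hD (isOpen_Ioi (a := c))).measurableSet
  set k : E n → ℝ≥0∞ := A.indicator fun x =>
    ENNReal.ofReal (-(a x * fderiv ℝ η x (gradient v x))) with hk
  -- Only the sum `I` is known to be integrable, not its two terms separately. Hence the comparison
  -- is made pointwise between positive and negative parts, and the finite integral of the negative
  -- part of `I` is cancelled at the end.
  have hpt : ∀ x, Q.indicator (fun x => ENNReal.ofReal (f x)) x + ENNReal.ofReal (-I x) ≤
      ENNReal.ofReal (I x) + k x := by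
    intro x
    by_cases hx : x ∈ D
    swap
    · have : I x = 0 := by
        simp only [hI, fderiv_of_notMem_tsupport ℝ fun h' => hx (hφD h'), zero_apply, mul_zero]
      rw [indicator_of_notMem fun h' => hx (hQD h'), this]
      simp
    have hf0 : 0 ≤ f x := by
      have := ha0 x hx
      have := expNegInvGlue.nonneg (v x - c)
      positivity
    have h1 : Q.indicator (fun x => ENNReal.ofReal (f x)) x ≤ ENNReal.ofReal (f x * η x) := by
      by_cases hxQ : x ∈ Q
      · rw [indicator_of_mem hxQ, hηQ x hxQ, mul_one]
      · rw [indicator_of_notMem hxQ]; exact zero_le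
    have h2 : ENNReal.ofReal
        (-(expNegInvGlue (v x - c) * (a x * fderiv ℝ η x (gradient v x)))) ≤ k x := by
      by_cases hxA : x ∈ A
      · rw [hk, indicator_of_mem hxA, ← mul_neg]
        rcases le_total 0 (-(a x * fderiv ℝ η x (gradient v x))) with hy | hy
        · exact ENNReal.ofReal_le_ofReal (mul_le_of_le_one_left hy (expNegInvGlue_le_one _))
        · rw [ENNReal.ofReal_of_nonpos
            (mul_nonpos_of_nonneg_of_nonpos (expNegInvGlue.nonneg _) hy)]
          exact zero_le
      · have : v x - c ≤ 0 := by
          by_contra hcon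
          exact hxA ⟨hx, by linarith⟩
        rw [expNegInvGlue.zero_of_nonpos this]
        simp
    refine (add_le_add_left h1 _).trans (le_trans ?_ (add_le_add_right h2 _))
    have hη0 := mul_nonneg hf0 (hη01 x).1
    rw [hderiv x hx]
    generalize f x * η x = y at hη0 ⊢
    generalize expNegInvGlue (v x - c) * (a x * fderiv ℝ η x (gradient v x)) = z
    rcases le_total 0 (y + z) with hyz | hyz
    · rw [ENNReal.ofReal_of_nonpos (neg_nonpos.2 hyz), add_zero]
      refine le_trans (ENNReal.ofReal_le_ofReal ?_) ENNReal.ofReal_add_le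
      linarith
    · rw [ENNReal.ofReal_of_nonpos hyz, zero_add, ← ENNReal.ofReal_add hη0 (by linarith)]
      exact ENNReal.ofReal_le_ofReal (by linarith)
  have hIm : AEMeasurable (fun x => ENNReal.ofReal (-I x)) :=
    hint.neg.aestronglyMeasurable.aemeasurable.ennreal_ofReal
  have hIm' : AEMeasurable (fun x => ENNReal.ofReal (I x)) :=
    hint.aestronglyMeasurable.aemeasurable.ennreal_ofReal
  have hsum := lintegral_mono (μ := volume) hpt
  rw [lintegral_add_right' _ hIm, lintegral_add_left' hIm', lintegral_indicator hQ,
    lintegral_indicator hAm] at hsum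
  have hsum' := hsum.trans (add_le_add_left hparts _)
  rw [add_comm] at hsum'
  exact (ENNReal.add_le_add_iff_left hint.neg.lintegral_lt_top.ne).1 hsum'

end

/-! ### Cones in the space form -/

section


variable {n : ℕ} {K : ℝ} {W : Set (sphere (0 : E n) 1)}

theorem cone_subset_M : cone K W ⊆ M n K := fun _ hx => hx.1

theorem zero_notMem_cone : (0 : E n) ∉ cone K W := by
  rintro ⟨-, s, hs, θ, -, h⟩
  have h1 : ‖(θ : E n)‖ = 1 := by simp
  have h2 := congrArg norm h
  rw [norm_smul, h1, norm_zero, mul_one, Real.norm_of_nonneg hs.le] at h2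
  exact hs.ne h2

theorem isOpen_cone (hW : IsOpen W) : IsOpen (cone K W) := by
  obtain ⟨O, hO, rfl⟩ := isOpen_induced_iff.1 hW
  have h : cone K (Subtype.val ⁻¹' O) = M n K ∩ ({0}ᶜ ∩ (fun x : E n => ‖x‖⁻¹ • x) ⁻¹' O) := by
    ext x
    constructor
    · rintro hx
      refine ⟨hx.1, fun h0 => zero_notMem_cone (h0 ▸ hx), ?_⟩
      obtain ⟨-, s, hs, θ, hθ, rfl⟩ := hx
      have h1 : ‖(θ : E n)‖ = 1 := by simp
      have : ‖s • (θ : E n)‖⁻¹ • s • (θ : E n) = θ := by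
        rw [norm_smul, h1, mul_one, Real.norm_of_nonneg hs.le, inv_smul_smul₀ hs.ne']
      rw [mem_preimage, this]
      exact hθ
    · rintro ⟨hM, h0, hx⟩
      have h1 : ‖x‖ ≠ 0 := norm_ne_zero_iff.2 h0
      refine ⟨hM, ‖x‖, norm_pos_iff.2 h0, ⟨‖x‖⁻¹ • x, ?_⟩, hx, (smul_inv_smul₀ h1 x).symm⟩
      simp [norm_smul, h1]
  rw [h]
  refine (isOpen_M n K).inter (ContinuousOn.isOpen_inter_preimage ?_ isOpen_compl_singleton hO)
  exact (continuousOn_id.norm.inv₀ fun x hx => norm_ne_zero_iff.2 hx).smul continuousOn_id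

/-- A truncated cone over a connected base is connected. -/
theorem isPreconnected_cone_inter_ball (hW : IsPreconnected W) {r : ℝ} :
    IsPreconnected (cone K W ∩ ball 0 r) := by
  let I : Set ℝ := {s | 0 < s ∧ 0 < 1 + K / 4 * s ^ 2 ∧ s < r}
  have hI : I.OrdConnected := by
    refine ⟨fun s hs t ht u hu => ⟨hs.1.trans_le hu.1, ?_, hu.2.trans_lt ht.2.2⟩⟩
    have hs0 := hs.1
    have hs1 := hs.2.1
    have ht1 := ht.2.1
    have h1 : s ^ 2 ≤ u ^ 2 := pow_le_pow_left₀ hs0.le hu.1 2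
    have h2 : u ^ 2 ≤ t ^ 2 := pow_le_pow_left₀ (hs0.le.trans hu.1) hu.2 2
    rcases le_total 0 (K / 4) with hK | hK <;> nlinarith
  have h : cone K W ∩ ball 0 r = 
      (fun y : ℝ × sphere (0 : E n) 1 => y.1 • (y.2 : E n)) '' I ×ˢ W := by
    ext x
    constructor
    · rintro ⟨⟨hM, s, hs, θ, hθ, rfl⟩, hx⟩
      have h1 : ‖(θ : E n)‖ = 1 := by simp
      have h2 : ‖s • (θ : E n)‖ = s := by
        rw [norm_smul, h1, mul_one, Real.norm_of_nonneg hs.le]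
      rw [M, mem_ofPred_eq, h2] at hM
      rw [mem_ball_zero_iff, h2] at hx
      exact ⟨(s, θ), ⟨⟨hs, hM, hx⟩, hθ⟩, rfl⟩
    · rintro ⟨⟨s, θ⟩, ⟨⟨hs, hM, hx⟩, hθ⟩, rfl⟩
      have h1 : ‖(θ : E n)‖ = 1 := by simp
      have h2 : ‖s • (θ : E n)‖ = s := by
        rw [norm_smul, h1, mul_one, Real.norm_of_nonneg hs.le]
      refine ⟨⟨?_, s, hs, θ, hθ, rfl⟩, ?_⟩
      · simp only [M, mem_ofPred_eq, h2]; exact hM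
      · simpa only [mem_ball_zero_iff, h2] using hx
  rw [h]
  refine (hI.isPreconnected.prod hW).image _ ?_
  exact (continuous_fst.smul (continuous_subtype_val.comp continuous_snd)).continuousOn

theorem isPreconnected_cone (hW : IsPreconnected W) : IsPreconnected (cone K W) := by
  refine isPreconnected_of_forall_pair fun x hx y hy => ?_
  obtain ⟨r, hr⟩ := exists_gt (max ‖x‖ ‖y‖)
  exact ⟨cone K W ∩ ball 0 r, inter_subset_left,
    ⟨hx, mem_ball_zero_iff.2 ((le_max_left _ _).trans_lt hr)⟩,
    ⟨hy, mem_ball_zero_iff.2 ((le_max_right _ _).trans_lt hr)⟩, isPreconnected_cone_inter_ball hW⟩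

/-- Since `1 - s²/4 ≤ 2 - s`, the distance dominates `log 2 - log (2 - ‖x‖)`. So hyperbolically
bounded sets stay away from the ideal boundary `‖x‖ = 2`. -/
theorem norm_le_of_poleDist_le {x : E n} (hx : x ∈ M n (-1)) {ρ : ℝ} (h : poleDist (-1) x ≤ ρ) :
    ‖x‖ ≤ 2 - 2 * Real.exp (-ρ) := by
  have hx2 : ‖x‖ < 2 := by
    rw [M, mem_ofPred_eq] at hx
    nlinarith [norm_nonneg x]
  have hmem : ∀ s ∈ uIcc 0 ‖x‖, 0 < 2 - s ∧ 0 < 1 + -1 / 4 * s ^ 2 := by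
    intro s hs
    rw [uIcc_of_le (norm_nonneg x)] at hs
    have h1 : s < 2 := hs.2.trans_lt hx2
    refine ⟨by linarith, ?_⟩
    nlinarith [hs.1]
  have hc1 : ContinuousOn (fun s : ℝ => (2 - s)⁻¹) (uIcc 0 ‖x‖) :=
    ContinuousOn.inv₀ (by fun_prop) fun s hs => (hmem s hs).1.ne'
  have hc2 : ContinuousOn (fun s : ℝ => (1 + -1 / 4 * s ^ 2)⁻¹) (uIcc 0 ‖x‖) :=
    ContinuousOn.inv₀ (by fun_prop) fun s hs => (hmem s hs).2.ne'
  have hmono : ∫ s in (0 : ℝ)..‖x‖, (2 - s)⁻¹ ≤ poleDist (-1) x := by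
    refine intervalIntegral.integral_mono_on (norm_nonneg x) hc1.intervalIntegrable
      hc2.intervalIntegrable fun s hs => ?_
    have h2 := hmem s (by rwa [uIcc_of_le (norm_nonneg x)])
    refine inv_anti₀ h2.2 ?_
    nlinarith [hs.1]
  have hint : ∫ s in (0 : ℝ)..‖x‖, (2 - s)⁻¹ = -Real.log (2 - ‖x‖) - -Real.log (2 - 0) := by
    refine intervalIntegral.integral_eq_sub_of_hasDerivAt (f := fun s => -Real.log (2 - s))
      (fun s hs => ?_) hc1.intervalIntegrable
    have := (((hasDerivAt_id s).const_sub 2).log (hmem s hs).1.ne').neg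
    convert! this using 1
    simp only [id]
    ring
  rw [hint, sub_zero] at hmono
  have h3 : Real.log 2 - ρ ≤ Real.log (2 - ‖x‖) := by linarith
  rw [Real.le_log_iff_exp_le (by linarith), sub_eq_add_neg, Real.exp_add,
    Real.exp_log two_pos] at h3
  linarith

/-- The bound on `conf · ‖x‖` supplies, after raising to the power `n - 2`, the decay required of
the weight at infinity. For `K = 1` it is `‖x‖ ≤ 1 + ‖x‖²/4`, without any use of boundedness. -/
theorem closure_subset_M_and_exists_bound (hK : K = 0 ∨ K = 1 ∨ K = -1) {D : Set (E n)}
    (hD : D ⊆ M n K) (hb : ∃ ρ : ℝ, ∀ x ∈ D, poleDist K x ≤ ρ) :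
    closure D ⊆ M n K ∧ ∃ C : ℝ, 0 ≤ C ∧ ∀ x ∈ D, conf K x * ‖x‖ ≤ C := by
  obtain ⟨ρ, hρ⟩ := hb
  rcases hK with rfl | rfl | rfl
  · refine ⟨fun x _ => by simp [M], max ρ 0, le_max_right _ _, fun x hx => ?_⟩
    have := hρ x hx
    simp only [poleDist, conf] at this ⊢
    simp at this ⊢
    exact Or.inl this
  · refine ⟨fun x _ => ?_, 1, zero_le_one, fun x _ => ?_⟩
    · show 0 < 1 + 1 / 4 * ‖x‖ ^ 2
      positivity
    · rw [conf, inv_mul_le_iff₀ (by positivity)]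
      nlinarith [sq_nonneg (‖x‖ - 2)]
  · set q := 2 - 2 * Real.exp (-ρ)
    have hq : q < 2 := by simp only [q]; linarith [Real.exp_pos (-ρ)]
    have hDq : closure D ⊆ closedBall 0 q := closure_minimal
      (fun x hx => mem_closedBall_zero_iff.2 (norm_le_of_poleDist_le (hD hx) (hρ x hx)))
      isClosed_closedBall
    have hM : closure D ⊆ M n (-1) := fun x hx => by
      have := mem_closedBall_zero_iff.1 (hDq hx)
      show 0 < 1 + -1 / 4 * ‖x‖ ^ 2
      nlinarith [norm_nonneg x]
    refine ⟨hM, ?_⟩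
    have hc : IsCompact (closure D) := (isCompact_closedBall 0 q).of_isClosed_subset
      isClosed_closure hDq
    have hcont : ContinuousOn (fun x : E n => conf (-1) x * ‖x‖) (closure D) :=
      ((contDiffOn_conf (-1)).continuousOn.mono hM).mul continuousOn_id.norm
    obtain ⟨C, hC⟩ := hc.exists_bound_of_continuousOn hcont
    exact ⟨max C 0, le_max_right _ _, fun x hx =>
      (le_abs_self _).trans ((hC x (subset_closure hx)).trans (le_max_left _ _))⟩

/-- Moving from `p` by `s e`, with `Dψ(p) e = -1`, gives a centre `q` towards which `{ψ ≤ 0}` is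
locally star-shaped, even uniformly for targets near `q`: strict differentiability makes the linear
decrease dominate along each segment. -/
theorem exists_segments_to_point {ψ : E n → ℝ} {p : E n} (hψ : HasStrictFDerivAt ψ (fderiv ℝ ψ p) p)
    (hψ' : fderiv ℝ ψ p ≠ 0) {N : Set (E n)} (hN : N ∈ 𝓝 p) :
    ∃ r > 0, ∃ q, ball p r ⊆ N ∧ ∀ x ∈ ball p r, ψ x ≤ 0 → ∀ y ∈ ball q r, ∀ τ ∈ Ioc (0 : ℝ) 1,
      x + τ • (y - x) ∈ N ∧ ψ (x + τ • (y - x)) < 0 := by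
  obtain ⟨e, he⟩ : ∃ e, fderiv ℝ ψ p e = -1 := by
    obtain ⟨u, hu⟩ : ∃ u, fderiv ℝ ψ p u ≠ 0 := by
      by_contra! hcon
      exact hψ' (ContinuousLinearMap.ext hcon)
    exact ⟨-(fderiv ℝ ψ p u)⁻¹ • u, by simp [hu]⟩
  set κ : ℝ≥0 := ⟨1 / (2 * (‖e‖ + 1)), by positivity⟩ with hκ
  have hκv : (κ : ℝ) = 1 / (2 * (‖e‖ + 1)) := rfl
  have hκ0 : 0 < κ := by
    rw [← NNReal.coe_pos, hκv]
    positivity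
  obtain ⟨T, hT, hA⟩ := hψ.approximates_deriv_on_nhds (c := κ) (Or.inr hκ0)
  obtain ⟨R, hR, hRT⟩ := Metric.mem_nhds_iff.1 (inter_mem hT hN)
  set s : ℝ := R / (2 * (‖e‖ + 1)) with hs
  have hs0 : 0 < s := by positivity
  have hse : s * (2 * (‖e‖ + 1)) = R := by rw [hs]; field_simp
  set Λ := ‖fderiv ℝ ψ p‖
  have hΛ : 0 ≤ Λ := norm_nonneg _
  -- Along a full segment the linear part is at most `-s + s/4` and the error at most `s/2 + s/8`,
  -- which leaves a decrease of at least `s/8`.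
  set r : ℝ := s / (8 * (Λ + 1)) with hr
  have hr0 : 0 < r := by positivity
  have hrs : r * (8 * (Λ + 1)) = s := by rw [hr]; field_simp
  have hrs' : 8 * r ≤ s := by nlinarith
  have hne := norm_nonneg e
  have hrR : r < R := by nlinarith
  have hκ1 : (κ : ℝ) * ‖e‖ ≤ 1 / 2 := by
    rw [hκv, div_mul_eq_mul_div, div_le_div_iff₀ (by positivity) (by positivity)]
    linarith
  have hκ2 : (κ : ℝ) ≤ 1 / 2 := by
    rw [hκv, div_le_div_iff₀ (by positivity) (by positivity)]
    linarith
  refine ⟨r, hr0, p + s • e, ((ball_subset_ball hrR.le).trans hRT).trans inter_subset_right,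
    fun x hx hψx y hy τ hτ => ?_⟩
  have hxR : x ∈ ball p R := ball_subset_ball hrR.le hx
  have hyR : y ∈ ball p R := by
    rw [mem_ball, dist_eq_norm] at hy ⊢
    have h1 : y - p = (y - (p + s • e)) + s • e := by abel
    rw [h1]
    refine (norm_add_le _ _).trans_lt ?_
    rw [norm_smul, Real.norm_of_nonneg hs0.le]
    nlinarith
  have hzR : x + τ • (y - x) ∈ ball p R :=
    (convex_ball p R).add_smul_sub_mem hxR hyR ⟨hτ.1.le, hτ.2⟩
  refine ⟨(hRT hzR).2, ?_⟩
  have hap := hA _ (hRT hzR).1 _ (hRT hxR).1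
  rw [add_sub_cancel_left, map_smul, norm_smul, Real.norm_of_nonneg hτ.1.le, smul_eq_mul] at hap
  set w := (y - (p + s • e)) + (p - x) with hw
  have hwn : ‖w‖ ≤ 2 * r := by
    refine (norm_add_le _ _).trans ?_
    rw [mem_ball, dist_eq_norm] at hx hy
    rw [norm_sub_rev p x]
    linarith
  have hyx : y - x = s • e + w := by rw [hw]; abel
  have h2 : fderiv ℝ ψ p (y - x) ≤ -s + Λ * (2 * r) := by
    rw [hyx, map_add, map_smul, he, smul_eq_mul, mul_neg_one]
    gcongr
    exact (le_abs_self _).trans (((fderiv ℝ ψ p).le_opNorm w).trans (by gcongr))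
  have h3 : ‖y - x‖ ≤ s * ‖e‖ + 2 * r := by
    rw [hyx]
    refine (norm_add_le _ _).trans ?_
    rw [norm_smul, Real.norm_of_nonneg hs0.le]
    gcongr
  have h4 : (κ : ℝ) * ‖y - x‖ ≤ s / 2 + r := by
    refine (mul_le_mul_of_nonneg_left h3 κ.2).trans ?_
    nlinarith
  have h5 := (le_abs_self _).trans hap
  have h6 : fderiv ℝ ψ p (y - x) + κ * ‖y - x‖ < 0 := by nlinarith
  nlinarith [hτ.1]

end

/-! ### Geometry of annular sector-like domains -/

section


variable {n : ℕ} {K : ℝ} {W : Set (sphere (0 : E n) 1)} {Ω₁ Ω₂ : Set (E n)}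

theorem subset_of_disjoint_frontier {X : Type*} [TopologicalSpace X] {s t : Set X}
    (hs : IsPreconnected s) (hst : (s ∩ t).Nonempty) (h : ∀ x ∈ s, x ∉ frontier t) : s ⊆ t := by
  refine (hs.subset_left_of_subset_union isOpen_interior isClosed_closure.isOpen_compl
    (disjoint_compl_right_iff_subset.2 interior_subset_closure) (fun x hx => ?_) ?_).trans
    interior_subset
  · by_contra hcon
    rw [mem_union, not_or, notMem_compl_iff] at hcon
    exact h x hx ⟨hcon.2, hcon.1⟩
  · obtain ⟨x, hx, hxt⟩ := hst
    refine ⟨x, hx, ?_⟩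
    by_contra hcon
    exact h x hx ⟨subset_closure hxt, hcon⟩

theorem isOpen_Omega (h₁ : IsOpen Ω₁) : IsOpen (Omega Ω₁ Ω₂) := h₁.sdiff isClosed_closure

theorem Omega_subset : Omega Ω₁ Ω₂ ⊆ Ω₁ := sdiff_subset

namespace IsAnnularSectorLike

theorem isOpen_cone (H : IsAnnularSectorLike K W Ω₁ Ω₂) : IsOpen (cone K W) :=
  SpaceForm.isOpen_cone H.convex_cone.1

theorem isPreconnected_cone (H : IsAnnularSectorLike K W Ω₁ Ω₂) : IsPreconnected (cone K W) :=
  SpaceForm.isPreconnected_cone H.convex_cone.2.1.isPreconnected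

theorem isOpen_Omega (H : IsAnnularSectorLike K W Ω₁ Ω₂) : IsOpen (Omega Ω₁ Ω₂) :=
  SpaceForm.isOpen_Omega H.isOpen₁

theorem Omega_subset_cone (H : IsAnnularSectorLike K W Ω₁ Ω₂) : Omega Ω₁ Ω₂ ⊆ cone K W :=
  Omega_subset.trans H.subset₁

theorem frontier_inter_cone_subset (H : IsAnnularSectorLike K W Ω₁ Ω₂) :
    frontier (Omega Ω₁ Ω₂) ∩ cone K W ⊆ Gamma0 K W Ω₁ ∪ Gamma2 K W Ω₂ := by
  rintro x ⟨hx, hxc⟩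
  have hxΩ : x ∉ Omega Ω₁ Ω₂ := fun h => hx.2 (H.isOpen_Omega.interior_eq.symm ▸ h)
  by_cases hx1 : x ∈ Ω₁
  · right
    have hx2 : x ∈ closure Ω₂ := by
      by_contra hcon
      exact hxΩ ⟨hx1, hcon⟩
    refine ⟨⟨hx2, fun h => ?_⟩, hxc⟩
    obtain ⟨y, hy1, hy2⟩ := mem_closure_iff.1 hx.1 _ isOpen_interior h
    exact hy2.2 (subset_closure (interior_subset hy1))
  · exact Or.inl ⟨⟨closure_mono Omega_subset hx.1, fun h => hx1 (interior_subset h)⟩, hxc⟩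

theorem Gamma1_disjoint_cone (H : IsAnnularSectorLike K W Ω₁ Ω₂) {p : E n}
    (hp : p ∈ Gamma1 K W Ω₁ Ω₂) : p ∉ cone K W := fun hpc =>
  hp.2 ((H.frontier_inter_cone_subset ⟨hp.1.1, hpc⟩).imp (subset_closure ·) (subset_closure ·))

theorem Gamma0_nonempty (H : IsAnnularSectorLike K W Ω₁ Ω₂) : (Gamma0 K W Ω₁).Nonempty := by
  by_contra hcon
  have := H.area_pos₀
  rw [not_nonempty_iff_eq_empty.1 hcon] at this
  simp [area] at this

/-- The contradiction in which both connectedness arguments over the whole cone end. -/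
theorem not_cone_subset (H : IsAnnularSectorLike K W Ω₁ Ω₂) : ¬cone K W ⊆ Ω₁ := by
  intro h
  obtain ⟨x, hx⟩ := H.Gamma0_nonempty
  exact hx.1.2 (H.isOpen₁.interior_eq.symm ▸ h hx.2)

theorem Gamma0_subset_closure (H : IsAnnularSectorLike K W Ω₁ Ω₂) :
    Gamma0 K W Ω₁ ⊆ closure (Omega Ω₁ Ω₂) := by
  rintro x ⟨hx, hxc⟩
  have hx2 : x ∉ closure Ω₂ := fun h =>
    hx.2 (H.isOpen₁.interior_eq.symm ▸ H.closure_subset ⟨h, hxc⟩)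
  refine mem_closure_iff.2 fun O hO hxO => ?_
  obtain ⟨y, ⟨hy1, hy2⟩, hy3⟩ := mem_closure_iff.1 hx.1 _
    (hO.inter isClosed_closure.isOpen_compl) ⟨hxO, hx2⟩
  exact ⟨y, hy1, hy3, hy2⟩

/-- A point of `Γ₂` may be interior to `closure Ω₂`, hence away from `Ω`. If all of them avoided
`closure Ω`, then `closure Ω₂` would have no frontier in the connected cone, and the cone would lie
in `closure Ω₂`, hence in `Ω₁`. -/
theorem Gamma2_inter_closure_nonempty (H : IsAnnularSectorLike K W Ω₁ Ω₂) :
    (Gamma2 K W Ω₂ ∩ closure (Omega Ω₁ Ω₂)).Nonempty := by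
  by_contra hcon
  obtain ⟨z, hz⟩ := H.isConnected₂.nonempty
  refine H.not_cone_subset fun x hx => H.closure_subset ⟨?_, hx⟩
  refine subset_of_disjoint_frontier H.isPreconnected_cone
    ⟨z, H.subset₂ hz, subset_closure hz⟩ (fun y hy hyf => hcon ?_) hx
  have hy2 : y ∈ closure Ω₂ := isClosed_closure.frontier_subset hyf
  refine ⟨y, ⟨⟨hy2, fun h => hyf.2 (interior_mono subset_closure h)⟩, hy⟩, ?_⟩
  refine mem_closure_iff.2 fun O hO hyO => ?_
  by_contra hne
  refine hyf.2 (mem_interior.2 ⟨O ∩ Ω₁, fun w hw => ?_, hO.inter H.isOpen₁,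
    hyO, H.closure_subset ⟨hy2, hy⟩⟩)
  by_contra hw2
  exact hne ⟨w, hw.1, hw.2, hw2⟩

/-- The boundary of the cone need not be smooth at the vertex, so it must be excluded. If `Γ₂` stays
away from `0`, then a small truncated cone, being connected and meeting `Ω₂`, lies in `Ω₂`, and `Ω`
does not approach `0`. -/
theorem zero_notMem_Gamma1 (H : IsAnnularSectorLike K W Ω₁ Ω₂) :
    (0 : E n) ∉ Gamma1 K W Ω₁ Ω₂ := by
  intro h0
  have h2 : (0 : E n) ∉ closure (Gamma2 K W Ω₂) := fun h => h0.2 (Or.inr h)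
  obtain ⟨r, hr, hball⟩ := Metric.mem_nhds_iff.1 (isClosed_closure.isOpen_compl.mem_nhds h2)
  obtain ⟨z, hz1, hz2⟩ := mem_closure_iff.1 H.pole_mem.1 _ isOpen_ball (mem_ball_self hr)
  have hsub : cone K W ∩ ball 0 r ⊆ Ω₂ := by
    refine subset_of_disjoint_frontier
      (isPreconnected_cone_inter_ball H.convex_cone.2.1.isPreconnected)
      ⟨z, ⟨H.subset₂ hz2, hz1⟩, hz2⟩ fun x hx hxf => ?_
    exact hball hx.2 (subset_closure ⟨hxf, hx.1⟩)
  obtain ⟨y, hy1, hy2⟩ := mem_closure_iff.1 h0.1.1.1 _ isOpen_ball (mem_ball_self hr)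
  exact hy2.2 (subset_closure (hsub ⟨H.Omega_subset_cone hy2, hy1⟩))

/-- Near a point of `Γ₁`, the set `Ω` is the sublevel set of a smooth defining function, and
`Ω ∪ Γ₁` is a set of unique differentiability. -/
theorem exists_local_defining (H : IsAnnularSectorLike K W Ω₁ Ω₂) {p : E n}
    (hp : p ∈ Gamma1 K W Ω₁ Ω₂) :
    ∃ (r : ℝ) (ψ : E n → ℝ), 0 < r ∧ IsDefiningFunction (Omega Ω₁ Ω₂) (ball p r) ψ ∧
      (∀ x ∈ ball p r, x ∈ OmegaGamma K W Ω₁ Ω₂ ↔ ψ x ≤ 0) ∧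
      (∀ x ∈ ball p r, ψ x = 0 → x ∈ Gamma1 K W Ω₁ Ω₂) ∧
      ∀ x ∈ ball p r, ψ x ≤ 0 → UniqueDiffWithinAt ℝ (OmegaGamma K W Ω₁ Ω₂) x := by
  have hp0 : p ≠ 0 := fun h => H.zero_notMem_Gamma1 (h ▸ hp)
  have hpf : p ∈ frontier (cone K W) :=
    ⟨closure_mono H.Omega_subset_cone hp.1.1.1, fun h => H.Gamma1_disjoint_cone hp
      (interior_subset h)⟩
  obtain ⟨U, ψ, hpU, ⟨hU, hψ, hψ', hcU⟩, hψp, -⟩ := H.convex_cone.2.2 p ⟨hpf, hp.1.2⟩ hp0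
  have hstrict : HasStrictFDerivAt ψ (fderiv ℝ ψ p) p :=
    (hψ.contDiffAt (hU.mem_nhds hpU)).hasStrictFDerivAt (by simp)
  -- In `N` the frontier of `Ω` cannot enter the cone, whose points there are exactly those with `ψ
  -- < 0`.
  set N : Set (E n) := U ∩ M n K ∩ (closure (Gamma0 K W Ω₁) ∪ closure (Gamma2 K W Ω₂))ᶜ with hN
  have hNo : IsOpen N := (hU.inter (isOpen_M n K)).inter
    (isClosed_closure.union isClosed_closure).isOpen_compl
  obtain ⟨r, hr, q, hrN, hseg⟩ := exists_segments_to_point hstrict (hψ' p hpU)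
    (hNo.mem_nhds ⟨⟨hpU, hp.1.2⟩, hp.2⟩)
  have hcone : ∀ x ∈ N, ψ x < 0 → x ∈ cone K W := fun x hx hx' =>
    (hcU.symm ▸ (⟨hx.1.1, hx'⟩ : x ∈ {x ∈ U | ψ x < 0}) : x ∈ cone K W ∩ U).1
  have hneg : ∀ x ∈ N, x ∈ cone K W → ψ x < 0 := fun x hx hx' =>
    (hcU ▸ (⟨hx', hx.1.1⟩ : x ∈ cone K W ∩ U) : x ∈ {x ∈ U | ψ x < 0}).2
  have hfr : ∀ x ∈ N, ψ x < 0 → x ∉ frontier (Omega Ω₁ Ω₂) := fun x hx hx' hxf =>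
    hx.2 ((H.frontier_inter_cone_subset ⟨hxf, hcone x hx hx'⟩).imp
      (subset_closure ·) (subset_closure ·))
  -- Segments to `q` avoid the frontier of `Ω`. As `Ω` has points near `p`, it contains `q`, and
  -- then every point of the ball with `ψ < 0`.
  have hS : ∀ x ∈ ball p r, ψ x < 0 → ∀ z ∈ segment ℝ x q, z ∉ frontier (Omega Ω₁ Ω₂) := by
    intro x hx hx' z hz
    rw [segment_eq_image'] at hz
    obtain ⟨τ, hτ, rfl⟩ := hz
    rcases hτ.1.eq_or_lt with h | h
    · simp only [← h, zero_smul, add_zero]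
      exact hfr x (hrN hx) hx'
    · obtain ⟨h1, h2⟩ := hseg x hx hx'.le q (mem_ball_self hr) τ ⟨h, hτ.2⟩
      exact hfr _ h1 h2
  have hconn : ∀ x y : E n, IsPreconnected (segment ℝ x y) := fun x y =>
    (convex_segment x y).isPreconnected
  have hqΩ : q ∈ Omega Ω₁ Ω₂ := by
    obtain ⟨y, hy1, hy2⟩ := mem_closure_iff.1 hp.1.1.1 _ isOpen_ball (mem_ball_self hr)
    refine subset_of_disjoint_frontier (hconn y q) ⟨y, left_mem_segment ℝ y q, hy2⟩
      (hS y hy1 (hneg y (hrN hy1) (H.Omega_subset_cone hy2))) (right_mem_segment ℝ y q)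
  have hΩ : ∀ x ∈ ball p r, ψ x < 0 → x ∈ Omega Ω₁ Ω₂ := fun x hx hx' =>
    subset_of_disjoint_frontier (hconn x q) ⟨q, right_mem_segment ℝ x q, hqΩ⟩
      (hS x hx hx') (left_mem_segment ℝ x q)
  have hΩ' : ∀ x ∈ ball p r, x ∈ Omega Ω₁ Ω₂ → ψ x < 0 := fun x hx hx' =>
    hneg x (hrN hx) (H.Omega_subset_cone hx')
  have hψc : ∀ x ∈ ball p r, ContinuousAt ψ x := fun x hx =>
    (hψ.contDiffAt (hU.mem_nhds (hrN hx).1.1)).continuousAt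
  have hcl : ∀ x ∈ ball p r, x ∈ closure (Omega Ω₁ Ω₂) → ψ x ≤ 0 := by
    intro x hx hxc
    by_contra hcon
    obtain ⟨y, hy1, hy2⟩ := mem_closure_iff_nhds.1 hxc _
      (inter_mem ((hψc x hx).eventually (Ioi_mem_nhds (not_le.1 hcon))) (isOpen_ball.mem_nhds hx))
    exact lt_asymm hy1.1 (hΩ' y hy1.2 hy2)
  have hcl' : ∀ x ∈ ball p r, ψ x ≤ 0 → x ∈ closure (Omega Ω₁ Ω₂) := by
    intro x hx hx'
    have hlim : Tendsto (fun τ : ℝ => x + τ • (q - x)) (𝓝[>] 0) (𝓝 x) := by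
      have : Continuous fun τ : ℝ => x + τ • (q - x) := by fun_prop
      have h1 := this.tendsto 0
      simp only [zero_smul, add_zero] at h1
      exact h1.mono_left nhdsWithin_le_nhds
    refine mem_closure_of_tendsto hlim ?_
    filter_upwards [hlim (isOpen_ball.mem_nhds hx), Ioc_mem_nhdsGT one_pos] with τ h1 h2
    exact hΩ _ h1 (hseg x hx hx' q (mem_ball_self hr) τ h2).2
  have hG1 : ∀ x ∈ ball p r, ψ x = 0 → x ∈ Gamma1 K W Ω₁ Ω₂ := fun x hx hx' =>
    ⟨⟨⟨hcl' x hx hx'.le, fun h => (hΩ' x hx (interior_subset h)).ne hx'⟩, (hrN hx).1.2⟩,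
      (hrN hx).2⟩
  have hOG : ∀ x ∈ ball p r, x ∈ OmegaGamma K W Ω₁ Ω₂ ↔ ψ x ≤ 0 := by
    intro x hx
    constructor
    · rintro (((h | h) | h) | h)
      · exact (hΩ' x hx h).le
      · exact absurd (Or.inl (subset_closure h)) (hrN hx).2
      · exact hcl x hx h.1.1.1
      · exact absurd (Or.inr (subset_closure h)) (hrN hx).2
    · intro h
      rcases h.lt_or_eq with h | h
      · exact Or.inl (Or.inl (Or.inl (hΩ x hx h)))
      · exact Or.inl (Or.inr (hG1 x hx h))
  refine ⟨r, ψ, hr, ⟨isOpen_ball, hψ.mono fun x hx => (hrN hx).1.1,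
    fun x hx => hψ' x (hrN hx).1.1, ?_⟩, hOG, hG1, fun x hx hx' => ?_⟩
  · ext x
    exact ⟨fun h => ⟨h.2, hΩ' x h.2 h.1⟩, fun h => ⟨hΩ x h.1 h.2, h.1⟩⟩
  -- The join of `x` with a ball around `q` is convex with nonempty interior, and near `x` it lies
  -- in `Ω ∪ Γ₁`.
  · have hT : UniqueDiffWithinAt ℝ (convexJoin ℝ {x} (ball q r)) x := by
      refine uniqueDiffWithinAt_convex ((convex_singleton x).convexJoin (convex_ball q r))
        ⟨q, mem_interior.2 ⟨ball q r, subset_convexJoin_right (singleton_nonempty x),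
          isOpen_ball, mem_ball_self hr⟩⟩ (subset_closure ?_)
      exact subset_convexJoin_left (nonempty_ball.2 hr) (mem_singleton x)
    refine (hT.inter (isOpen_ball.mem_nhds hx)).mono ?_
    rintro z ⟨hz, hzb⟩
    refine (hOG z hzb).2 ?_
    rw [mem_convexJoin] at hz
    obtain ⟨_, rfl, y, hy, hz⟩ := hz
    rw [segment_eq_image'] at hz
    obtain ⟨τ, hτ, rfl⟩ := hz
    rcases hτ.1.eq_or_lt with h | h
    · simpa [← h] using hx'
    · exact (hseg _ hx hx' y hy τ ⟨h, hτ.2⟩).2.le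

end IsAnnularSectorLike

end

/-! ### Removability of the boundary -/

section


variable {n : ℕ} {K : ℝ} {W : Set (sphere (0 : E n) 1)} {Ω₁ Ω₂ A Q : Set (E n)} {a v : E n → ℝ}

theorem fderiv_apply_gradient_comm (φ v : E n → ℝ) (x : E n) :
    fderiv ℝ φ x (gradient v x) = fderiv ℝ v x (gradient φ x) := by
  rw [fderiv_apply_gradient, fderiv_apply_gradient]
  exact Finset.sum_congr rfl fun i _ => mul_comm _ _

theorem norm_gradient (v : E n → ℝ) (x : E n) : ‖gradient v x‖ = ‖fderiv ℝ v x‖ :=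
  LinearIsometryEquiv.norm_map _ _

namespace IsAnnularSectorLike

/-- Since `v` is `C¹` up to `Γ₁`, near `p` its gradient is bounded, and the boundary sign of the
normal derivative persists up to an error `w` in a thin layer. These are the hypotheses of
`exists_removable_nhds_neumann`. -/
theorem exists_removable_nhds_Gamma1 (H : IsAnnularSectorLike K W Ω₁ Ω₂)
    (hv : ContDiffOn ℝ 1 v (OmegaGamma K W Ω₁ Ω₂))
    (hN : ∀ x ∈ Gamma1 K W Ω₁ Ω₂, ∀ ν : E n, IsOutwardUnitNormal K (Omega Ω₁ Ω₂) x ν →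
      fderivWithin ℝ v (OmegaGamma K W Ω₁ Ω₂) x ν ≤ 0)
    (ha0 : ∀ x ∈ A, 0 ≤ a x) (hA : MeasurableSet A) (hAΩ : A ⊆ Omega Ω₁ Ω₂) {p : E n}
    (hp : p ∈ Gamma1 K W Ω₁ Ω₂) (hac : ContinuousAt a p) (hQ : IsClosed Q) (hpQ : p ∉ Q) :
    ∃ t ∈ 𝓝 p, Removable a v A Q (t ∩ frontier (Omega Ω₁ Ω₂)) := by
  obtain ⟨r, ψ, hr, hdef, hOG, hG1, huniq⟩ := H.exists_local_defining hp
  obtain ⟨-, hψ, hψ', hΩ⟩ := id hdef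
  set s := OmegaGamma K W Ω₁ Ω₂ with hs
  have hmem : ∀ x ∈ Omega Ω₁ Ω₂, x ∈ ball p r → ψ x < 0 := fun x hx hxb =>
    (hΩ ▸ (⟨hx, hxb⟩ : x ∈ Omega Ω₁ Ω₂ ∩ ball p r) : x ∈ {x ∈ ball p r | ψ x < 0}).2
  have hsign : ∀ x ∈ ball p r, ψ x = 0 → fderivWithin ℝ v s x (gradient ψ x) ≤ 0 := by
    intro x hx hx0
    have h1 := hN x (hG1 x hx hx0) _ ⟨ball p r, ψ, hx, hdef, hx0, rfl⟩
    rw [unitNormal, map_smul, smul_eq_mul] at h1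
    have h2 : 0 < (conf K x * ‖gradient ψ x‖)⁻¹ := by
      have h3 := conf_pos (hG1 x hx hx0).1.2
      have h4 : 0 < ‖gradient ψ x‖ := by
        rw [norm_gradient]; exact norm_pos_iff.2 (hψ' x hx)
      positivity
    exact nonpos_of_mul_nonpos_right h1 h2
  have hball : ∀ x ∈ s ∩ ball p r, ball p r ∈ 𝓝 x := fun x hx => isOpen_ball.mem_nhds hx.2
  have hcont : ContinuousOn (fderivWithin ℝ v s) (s ∩ ball p r) := by
    have h1 : ContinuousOn (fderivWithin ℝ v (s ∩ ball p r)) (s ∩ ball p r) :=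
      (hv.mono inter_subset_left).continuousOn_fderivWithin
        (fun x hx => (huniq x hx.2 ((hOG x hx.2).1 hx.1)).inter (hball x hx)) le_rfl
    exact h1.congr fun x hx => (fderivWithin_inter (hball x hx)).symm
  set Z := closedBall p (r / 2) ∩ ψ ⁻¹' Iic 0 with hZ
  have hcb : closedBall p (r / 2) ⊆ ball p r := closedBall_subset_ball (by linarith)
  have hZc : IsCompact Z := (isCompact_closedBall p (r / 2)).of_isClosed_subset
    ((hψ.continuousOn.mono hcb).preimage_isClosed_of_isClosed isClosed_closedBall isClosed_Iic)
    inter_subset_left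
  have hZs : Z ⊆ s ∩ ball p r := fun x hx => ⟨(hOG x (hcb hx.1)).2 hx.2, hcb hx.1⟩
  have hgrad : ContinuousOn (gradient ψ) (ball p r) :=
    (InnerProductSpace.toDual ℝ (E n)).symm.continuous.comp_continuousOn
      (hψ.continuousOn_fderiv_of_isOpen isOpen_ball (by simp))
  set G : E n → ℝ := fun x => fderivWithin ℝ v s x (gradient ψ x)
  have hG : ContinuousOn G Z :=
    (hcont.mono hZs).clm_apply (hgrad.mono fun x hx => hcb hx.1)
  have hin : ∀ x ∈ Omega Ω₁ Ω₂, fderivWithin ℝ v s x = fderiv ℝ v x := fun x hx =>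
    fderivWithin_of_mem_nhds (mem_of_superset (H.isOpen_Omega.mem_nhds hx)
      fun y hy => Or.inl (Or.inl (Or.inl hy)))
  have hAZ : ∀ x ∈ A ∩ ball p (r / 2), x ∈ Z := fun x hx =>
    ⟨ball_subset_closedBall hx.2,
      (hmem x (hAΩ hx.1) (ball_subset_ball (by linarith) hx.2)).le⟩
  obtain ⟨B, hB⟩ := hZc.exists_bound_of_continuousOn (hcont.mono hZs)
  -- On the compact set `{G ≥ w}` in `Z` the function `ψ` has a maximum, which is negative because
  -- `G ≤ 0` on `{ψ = 0}`. Half of its modulus serves as the thickness `ρ`.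
  have hflux : ∀ w > 0, ∃ ρ > 0, ∀ x ∈ A ∩ ball p (r / 2), -ρ ≤ ψ x →
      fderiv ℝ ψ x (gradient v x) ≤ w := by
    intro w hw
    have hZw : IsCompact (Z ∩ G ⁻¹' Ici w) := hZc.of_isClosed_subset
      (hG.preimage_isClosed_of_isClosed hZc.isClosed isClosed_Ici) inter_subset_left
    have hGx : ∀ x ∈ A ∩ ball p (r / 2), fderiv ℝ ψ x (gradient v x) = G x := fun x hx => by
      rw [fderiv_apply_gradient_comm, ← hin x (hAΩ hx.1)]
    rcases (Z ∩ G ⁻¹' Ici w).eq_empty_or_nonempty with he | hne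
    · refine ⟨1, one_pos, fun x hx _ => ?_⟩
      rw [hGx x hx]
      by_contra hcon
      exact (he ▸ (⟨hAZ x hx, (not_le.1 hcon).le⟩ : x ∈ Z ∩ G ⁻¹' Ici w) : x ∈ (∅ : Set (E n)))
    · obtain ⟨z, hz, hmax⟩ := hZw.exists_isMaxOn hne
        (hψ.continuousOn.mono fun x hx => hcb hx.1.1)
      have hz0 : ψ z < 0 := by
        refine lt_of_le_of_ne hz.1.2 fun h0 => ?_
        have h1 : w ≤ G z := hz.2
        exact absurd (hsign z (hcb hz.1.1) h0) (not_le.2 (hw.trans_le h1))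
      refine ⟨-ψ z / 2, by linarith, fun x hx hxψ => ?_⟩
      rw [hGx x hx]
      by_contra hcon
      have h1 : ψ x ≤ ψ z := hmax (⟨hAZ x hx, (not_le.1 hcon).le⟩ : x ∈ Z ∩ G ⁻¹' Ici w)
      linarith
  obtain ⟨t, ht, hrem⟩ := exists_removable_nhds_neumann (a := a) (v := v) (B := B) ha0 hA hac hQ hpQ
    (isOpen_ball (x := p) (ε := r / 2)) (mem_ball_self (by linarith))
    (hψ.mono (ball_subset_ball (by linarith))) (hψ' p (mem_ball_self hr))
    (fun x hx => hmem x (hAΩ hx.1) (ball_subset_ball (by linarith) hx.2))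
    (fun x hx => by
      rw [norm_gradient, ← hin x (hAΩ hx.1)]
      exact hB x (hAZ x hx)) hflux
  refine ⟨t ∩ ball p (r / 2), inter_mem ht (ball_mem_nhds p (by linarith)), hrem.mono ?_⟩
  rintro x ⟨⟨hxt, hxb⟩, hxf⟩
  refine ⟨hxt, hxb, not_lt.1 fun hneg => hxf.2 ?_⟩
  rw [H.isOpen_Omega.interior_eq]
  have h1 : x ∈ {x ∈ ball p r | ψ x < 0} := ⟨ball_subset_ball (by linarith) hxb, hneg⟩
  rw [← hΩ] at h1
  exact h1.1

end IsAnnularSectorLike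

theorem eventually_notMem_of_lt {s : Set (E n)} {x : E n} {c : ℝ}
    (hv : ContinuousWithinAt v s x) (hA : ∀ y ∈ A, y ∈ s ∧ c < v y) (hx : v x < c) :
    ∀ᶠ y in 𝓝 x, y ∉ A := by
  filter_upwards [eventually_nhdsWithin_iff.1 (hv.eventually (Iio_mem_nhds hx))] with y hy hyA
  exact lt_asymm (hy (hA y hyA).1) (hA y hyA).2

theorem closure_diff_self_eq {S C F : Set (E n)} (hF : IsClosed F)
    (hS : S = F ∩ C) : closure S \ S = closure S \ C := by
  subst hS
  ext x
  refine ⟨fun h => ⟨h.1, fun hc => h.2 ⟨?_, hc⟩⟩, fun h => ⟨h.1, fun hc => h.2 hc.2⟩⟩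
  exact closure_minimal inter_subset_left hF h.1

/-- A bounded part of the boundary of a relatively closed hypersurface of the cone is removable. -/
theorem removable_bdry (ha : Measurable a) (ha0 : ∀ x ∈ A, 0 ≤ a x) (hA : MeasurableSet A)
    (hfin : ∫⁻ x in A, ENNReal.ofReal (a x * ‖gradient v x‖ ^ 2) ≠ ⊤)
    (hac : ContinuousOn a (M n K)) (hQ : IsClosed Q) {F S Z : Set (E n)} (hF : IsClosed F)
    (hC : IsOpen (cone K W)) (hS : S = F ∩ cone K W) (hQC : Q ⊆ cone K W)
    (hsm : IsSmoothSubmanifold 2 (bdry K S)) (hZ : IsCompact Z) (hZM : Z ⊆ M n K) :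
    Removable a v A Q (bdry K S ∩ Z) := by
  have hcl : ∀ x ∈ bdry K S, x ∈ closure S \ cone K W := fun x hx => by
    rw [← closure_diff_self_eq hF hS]; exact ⟨hx.1.1, hx.2⟩
  -- The boundary of `S` is what `closure S` has outside the open cone. This makes it closed within
  -- `Z` and disjoint from `Q`.
  have heq : bdry K S ∩ Z = (closure S \ cone K W) ∩ Z := by
    ext x
    refine ⟨fun h => ⟨hcl x h.1, h.2⟩, fun h => ⟨⟨⟨h.1.1, hZM h.2⟩, fun hxS => h.1.2 ?_⟩, h.2⟩⟩
    rw [hS] at hxS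
    exact hxS.2
  have hcomp : IsCompact (bdry K S ∩ Z) := by
    rw [heq]
    exact hZ.inter_left (isClosed_closure.sdiff hC)
  refine removable_of_isCompact ha hA hcomp fun p hp => ?_
  obtain ⟨U, G, hU, hpU, hG, hG', hGU⟩ := hsm p hp.1
  obtain ⟨t, ht, hrem⟩ := exists_removable_nhds_codim_two ha ha0 hA hfin
    (hac.continuousAt ((isOpen_M n K).mem_nhds (hZM hp.2))) hQ
    (fun h => (hcl p hp.1).2 (hQC h)) hU hpU hG (hG' p hpU)
  refine ⟨t ∩ U, inter_mem ht (hU.mem_nhds hpU), hrem.mono ?_⟩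
  rintro x ⟨⟨hxt, hxU⟩, hx, -⟩
  refine ⟨hxt, ?_⟩
  rw [← hGU]
  exact ⟨hx, hxU⟩

end

/-! ### The maximum principle -/

section


variable {n : ℕ} {K : ℝ} {W : Set (sphere (0 : E n) 1)} {Ω₁ Ω₂ Q : Set (E n)} {v : E n → ℝ}

namespace IsAnnularSectorLike

theorem closure_Omega_subset_M (H : IsAnnularSectorLike K W Ω₁ Ω₂)
    (hK : K = 0 ∨ K = 1 ∨ K = -1) : closure (Omega Ω₁ Ω₂) ⊆ M n K :=
  (closure_mono Omega_subset).trans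
    (closure_subset_M_and_exists_bound hK (H.subset₁.trans cone_subset_M) H.bounded₁).1

/-- A cutoff at infinity leaves a compact piece `Z` of the frontier. There the edges `∂Γ₀`, `∂Γ₂`
are removed first; off a neighbourhood of them each remaining point lies in `Γ₀`, `Γ₂` or `Γ₁`, and
compactness patches the local cutoffs. -/
theorem exists_cutoff (H : IsAnnularSectorLike K W Ω₁ Ω₂) (hn : 2 ≤ n)
    (hK : K = 0 ∨ K = 1 ∨ K = -1) {c₀ c₂ c : ℝ} (hc₀ : c₀ < c) (hc₂ : c₂ < c)
    (hv2 : ContDiffOn ℝ 2 v (Omega Ω₁ Ω₂)) (hv1 : ContDiffOn ℝ 1 v (OmegaGamma K W Ω₁ Ω₂))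
    (hvW : MemW12 K (Omega Ω₁ Ω₂) v) (h0 : ∀ x ∈ Gamma0 K W Ω₁, v x = c₀)
    (h1 : ∀ x ∈ Gamma1 K W Ω₁ Ω₂, ∀ ν : E n, IsOutwardUnitNormal K (Omega Ω₁ Ω₂) x ν →
      fderivWithin ℝ v (OmegaGamma K W Ω₁ Ω₂) x ν ≤ 0)
    (h2 : ∀ x ∈ Gamma2 K W Ω₂, v x = c₂) (hQ : IsCompact Q) (hQΩ : Q ⊆ Omega Ω₁ Ω₂)
    {ε : ℝ} (hε : 0 < ε) :
    ∃ η : E n → ℝ, ContDiff ℝ 1 η ∧ (∀ x, η x ∈ Icc (0 : ℝ) 1) ∧ HasCompactSupport η ∧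
      (∀ x ∈ frontier (Omega Ω₁ Ω₂), η =ᶠ[𝓝 x] fun _ => 0) ∧ (∀ x ∈ Q, η x = 1) ∧
      fluxDefect (fun x => conf K x ^ (n - 2)) v {x ∈ Omega Ω₁ Ω₂ | c < v x} η ≤
        ENNReal.ofReal ε := by
  set a : E n → ℝ := fun x => conf K x ^ (n - 2)
  set Ω := Omega Ω₁ Ω₂
  set A := {x ∈ Ω | c < v x}
  have hΩ : IsOpen Ω := H.isOpen_Omega
  have hΩM : Ω ⊆ M n K := H.Omega_subset_cone.trans cone_subset_M
  have hA : MeasurableSet A :=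
    (hv2.continuousOn.isOpen_inter_preimage hΩ (isOpen_Ioi (a := c))).measurableSet
  have hAΩ : A ⊆ Ω := fun x hx => hx.1
  have ha : Measurable a := (measurable_conf K).pow_const _
  have ha0 : ∀ x ∈ A, 0 ≤ a x := fun x hx => pow_nonneg (conf_pos (hΩM hx.1)).le _
  have hac : ContinuousOn a (M n K) := (contDiffOn_conf K).continuousOn.pow _
  have hfin : ∫⁻ x in A, ENNReal.ofReal (a x * ‖gradient v x‖ ^ 2) ≠ ⊤ :=
    ne_top_of_le_ne_top (lintegral_gradient_sq_ne_top hn hΩ hΩM (hv2.of_le (by norm_num)) hvW)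
      (lintegral_mono_set hAΩ)
  obtain ⟨C, hC0, hC⟩ :=
    (closure_subset_M_and_exists_bound hK (H.subset₁.trans cone_subset_M) H.bounded₁).2
  obtain ⟨η₁, k1, k2, k3, k4, k5⟩ := exists_compactSupport_cutoff hn ha ha0 hA hfin hQ.isBounded
    (C₀ := C ^ (n - 2)) (by positivity) (fun x hx => by
      rw [← mul_pow]
      exact pow_le_pow_left₀ (mul_nonneg (conf_pos (hΩM hx.1)).le (norm_nonneg _))
        (hC x (Omega_subset hx.1)) _) (half_pos hε)
  set Z := frontier Ω ∩ tsupport η₁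
  have hZ : IsCompact Z := k3.isCompact.inter_left isClosed_frontier
  have hZM : Z ⊆ M n K := fun x hx => H.closure_Omega_subset_M hK hx.1.1
  have hcone := H.isOpen_cone
  have hQC : Q ⊆ cone K W := hQΩ.trans H.Omega_subset_cone
  have hrem : Removable a v A Q Z := by
    refine ((removable_bdry ha ha0 hA hfin hac hQ.isClosed isClosed_frontier hcone rfl hQC
      H.bdry_smooth₀ hZ hZM).union ha hA (removable_bdry ha ha0 hA hfin hac hQ.isClosed
      isClosed_frontier hcone rfl hQC H.bdry_smooth₂ hZ hZM)).of_diff_open ha hA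
      fun O hO hsub => removable_of_isCompact ha hA (hZ.diff hO) fun p hp => ?_
    have hpQ : p ∉ Q := fun h => hp.1.1.2 (hΩ.interior_eq.symm ▸ hQΩ h)
    have hlow : p ∈ OmegaGamma K W Ω₁ Ω₂ → v p < c →
        ∃ t ∈ 𝓝 p, Removable a v A Q (t ∩ (Z \ O)) := by
      intro hpG hpc
      obtain ⟨t, ht, h⟩ := exists_removable_nhds_of_disjoint (a := a) (v := v) hQ.isClosed hpQ
        (eventually_notMem_of_lt (A := A) (hv1.continuousOn p hpG)
          (fun y hy => ⟨Or.inl (Or.inl (Or.inl hy.1)), hy.2⟩) hpc)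
      exact ⟨t, ht, h.mono inter_subset_left⟩
    by_cases hp0 : p ∈ closure (Gamma0 K W Ω₁)
    · have hpG : p ∈ Gamma0 K W Ω₁ := by
        by_contra hcon
        exact hp.2 (hsub (Or.inl ⟨⟨⟨hp0, hZM hp.1⟩, hcon⟩, hp.1⟩))
      exact hlow (Or.inl (Or.inl (Or.inr hpG))) (by rw [h0 p hpG]; exact hc₀)
    by_cases hp2 : p ∈ closure (Gamma2 K W Ω₂)
    · have hpG : p ∈ Gamma2 K W Ω₂ := by
        by_contra hcon
        exact hp.2 (hsub (Or.inr ⟨⟨⟨hp2, hZM hp.1⟩, hcon⟩, hp.1⟩))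
      exact hlow (Or.inr hpG) (by rw [h2 p hpG]; exact hc₂)
    obtain ⟨t, ht, h⟩ := H.exists_removable_nhds_Gamma1 hv1 h1 ha0 hA hAΩ
      ⟨⟨hp.1.1, hZM hp.1⟩, fun h => h.elim hp0 hp2⟩
      (hac.continuousAt ((isOpen_M n K).mem_nhds (hZM hp.1))) hQ.isClosed hpQ
    exact ⟨t, ht, h.mono (inter_subset_inter_right _ fun x hx => hx.1.1)⟩
  obtain ⟨η₂, l1, l2, l3, l4, l5⟩ := hrem (ε / 2) (half_pos hε)
  refine ⟨fun x => η₁ x * η₂ x, k1.mul l1, fun x => mul_mem_Icc (k2 x) (l2 x), k3.mul_right,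
    fun x hx => ?_, fun x hx => by simp [k4 x hx, l4 x hx], ?_⟩
  · by_cases hx' : x ∈ tsupport η₁
    · exact eventuallyEq_zero_mul (Or.inr (l3 x ⟨hx, hx'⟩))
    · exact eventuallyEq_zero_mul (Or.inl (notMem_tsupport_iff_eventuallyEq.1 hx'))
  · refine (fluxDefect_mul_le ha hA k1 l1 k2 l2).trans ((add_le_add k5 l5).trans ?_)
    rw [← ENNReal.ofReal_add (by linarith) (by linarith), add_halves]

/-- With `c` strictly between `max c₀ c₂` and `v x`, a nonzero gradient would make the energy
density positive on a small ball around `x`, whereas cutoffs equal to `1` on that ball bound its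
integral by every `ε`. -/
theorem gradient_eq_zero (H : IsAnnularSectorLike K W Ω₁ Ω₂) (hn : 2 ≤ n)
    (hK : K = 0 ∨ K = 1 ∨ K = -1) {c₀ c₂ : ℝ}
    (hv2 : ContDiffOn ℝ 2 v (Omega Ω₁ Ω₂)) (hv1 : ContDiffOn ℝ 1 v (OmegaGamma K W Ω₁ Ω₂))
    (hvW : MemW12 K (Omega Ω₁ Ω₂) v) (hlap : ∀ x ∈ Omega Ω₁ Ω₂, 0 ≤ laplacian K v x)
    (h0 : ∀ x ∈ Gamma0 K W Ω₁, v x = c₀)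
    (h1 : ∀ x ∈ Gamma1 K W Ω₁ Ω₂, ∀ ν : E n, IsOutwardUnitNormal K (Omega Ω₁ Ω₂) x ν →
      fderivWithin ℝ v (OmegaGamma K W Ω₁ Ω₂) x ν ≤ 0)
    (h2 : ∀ x ∈ Gamma2 K W Ω₂, v x = c₂) {x : E n} (hx : x ∈ Omega Ω₁ Ω₂)
    (hxc : max c₀ c₂ < v x) : gradient v x = 0 := by
  by_contra hne
  obtain ⟨c, hc, hcx⟩ := exists_between hxc
  set a : E n → ℝ := fun x => conf K x ^ (n - 2)
  set Ω := Omega Ω₁ Ω₂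
  have hΩ : IsOpen Ω := H.isOpen_Omega
  have hΩM : Ω ⊆ M n K := H.Omega_subset_cone.trans cone_subset_M
  have haC : ContDiffOn ℝ 1 a Ω := (((contDiffOn_conf K).of_le (by simp)).pow _).mono hΩM
  have ha0 : ∀ x ∈ Ω, 0 < a x := fun x hx => pow_pos (conf_pos (hΩM hx)) _
  have hsub : IsSubsolution a v Ω := fun y hy =>
    nonneg_of_mul_nonneg_right (hlap y hy) (inv_pos.2 (pow_pos (conf_pos (hΩM hy)) n))
  set f : E n → ℝ := fun x =>
    a x * ((v x - c)⁻¹ ^ 2 * expNegInvGlue (v x - c)) * ‖gradient v x‖ ^ 2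
  have hfx : 0 < f x := by
    have h3 := expNegInvGlue.pos_of_pos (sub_pos.2 hcx)
    have h4 := ha0 x hx
    have h5 := inv_pos.2 (sub_pos.2 hcx)
    have h6 := norm_pos_iff.2 hne
    positivity
  have hfc : ContinuousAt f x := by
    have hvx : ContinuousAt v x := hv2.continuousOn.continuousAt (hΩ.mem_nhds hx)
    have hg : ContinuousAt (gradient v) x :=
      (InnerProductSpace.toDual ℝ (E n)).symm.continuous.continuousAt.comp
        ((hv2.continuousOn_fderiv_of_isOpen hΩ (by norm_num)).continuousAt (hΩ.mem_nhds hx))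
    have hG : ContinuousAt (fun y => expNegInvGlue (v y - c)) x :=
      (expNegInvGlue.contDiff (n := 0)).continuous.continuousAt.comp
        (hvx.sub continuousAt_const)
    exact ((haC.continuousOn.continuousAt (hΩ.mem_nhds hx)).mul
      ((((hvx.sub continuousAt_const).inv₀ (sub_pos.2 hcx).ne').pow 2).mul hG)).mul (hg.norm.pow 2)
  have hev : ∀ᶠ y in 𝓝 x, f x / 2 < f y ∧ y ∈ Ω :=
    (hfc.eventually (Ioi_mem_nhds (half_lt_self hfx))).and (hΩ.mem_nhds hx)
  obtain ⟨ρ, hρ, hball⟩ := Metric.nhds_basis_closedBall.eventually_iff.1 hev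
  set Q := closedBall x ρ
  have hQΩ : Q ⊆ Ω := fun y hy => (hball hy).2
  have hle : ∀ ε : ℝ, 0 < ε → ∫⁻ y in Q, ENNReal.ofReal (f y) ≤ ENNReal.ofReal ε := by
    intro ε hε
    obtain ⟨η, k1, k2, k3, k4, k5, k6⟩ := H.exists_cutoff hn hK
      ((le_max_left _ _).trans_lt hc) ((le_max_right _ _).trans_lt hc) hv2 hv1 hvW h0 h1 h2
      (isCompact_closedBall x ρ) hQΩ hε
    exact (hsub.lintegral_le_fluxDefect hΩ haC (fun y hy => (ha0 y hy).le) hv2 c k1 k2 k3 k4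
      measurableSet_closedBall hQΩ k5).trans k6
  have hlow : ENNReal.ofReal (f x / 2) * volume Q ≤ ∫⁻ y in Q, ENNReal.ofReal (f y) := by
    rw [← setLIntegral_const]
    exact setLIntegral_mono' measurableSet_closedBall fun y hy =>
      ENNReal.ofReal_le_ofReal (hball hy).1.le
  have hpos : 0 < ENNReal.ofReal (f x / 2) * volume Q :=
    ENNReal.mul_pos (ENNReal.ofReal_pos.2 (half_pos hfx)).ne' (measure_closedBall_pos _ _ hρ).ne'
  obtain ⟨ε, hε, hεlt⟩ := ENNReal.lt_iff_exists_real_btwn.1 hpos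
  have hε0 : 0 < ε := ENNReal.ofReal_pos.1 hεlt.1
  exact absurd ((hlow.trans (hle ε hε0)).trans_lt hεlt.2) (lt_irrefl _)

/-- The weak maximum principle in `Ω`. -/
theorem le_max (H : IsAnnularSectorLike K W Ω₁ Ω₂) (hn : 2 ≤ n)
    (hK : K = 0 ∨ K = 1 ∨ K = -1) {c₀ c₂ : ℝ}
    (hv2 : ContDiffOn ℝ 2 v (Omega Ω₁ Ω₂)) (hv1 : ContDiffOn ℝ 1 v (OmegaGamma K W Ω₁ Ω₂))
    (hvW : MemW12 K (Omega Ω₁ Ω₂) v) (hlap : ∀ x ∈ Omega Ω₁ Ω₂, 0 ≤ laplacian K v x)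
    (h0 : ∀ x ∈ Gamma0 K W Ω₁, v x = c₀)
    (h1 : ∀ x ∈ Gamma1 K W Ω₁ Ω₂, ∀ ν : E n, IsOutwardUnitNormal K (Omega Ω₁ Ω₂) x ν →
      fderivWithin ℝ v (OmegaGamma K W Ω₁ Ω₂) x ν ≤ 0)
    (h2 : ∀ x ∈ Gamma2 K W Ω₂, v x = c₂) {x : E n} (hx : x ∈ Omega Ω₁ Ω₂) :
    v x ≤ max c₀ c₂ := by
  by_contra! hxc
  set Ω := Omega Ω₁ Ω₂
  have hΩ : IsOpen Ω := H.isOpen_Omega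
  have hP : IsOpen (Ω ∩ v ⁻¹' Ioi (max c₀ c₂)) :=
    hv2.continuousOn.isOpen_inter_preimage hΩ isOpen_Ioi
  -- The level set through `x` is open, since the gradient vanishes on `{v > max c₀ c₂}`. By
  -- continuity a frontier point of it in the cone would either belong to it or lie on `Γ₀ ∪ Γ₂`
  -- with the value `v x`, which exceeds `c₀` and `c₂`.
  set B := Ω ∩ v ⁻¹' {v x} with hB
  have hBo : IsOpen B := by
    have h3 := hP.isOpen_inter_preimage_of_fderiv_eq_zero (f := v) (𝕜 := ℝ)
      ((hv2.differentiableOn (by norm_num)).mono inter_subset_left) (fun y hy => by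
        have h4 := H.gradient_eq_zero hn hK hv2 hv1 hvW hlap h0 h1 h2 hy.1 hy.2
        rwa [gradient, map_eq_zero_iff _ (LinearIsometryEquiv.injective _)] at h4) {v x}
    suffices hBeq : B = Ω ∩ v ⁻¹' Ioi (max c₀ c₂) ∩ v ⁻¹' {v x} by rw [hBeq]; exact h3
    refine Set.ext fun y => ?_
    constructor
    · rintro ⟨hy, hyv⟩
      refine ⟨⟨hy, ?_⟩, hyv⟩
      rw [mem_preimage, mem_singleton_iff.1 hyv]
      exact hxc
    · rintro ⟨⟨hy, -⟩, hyv⟩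
      exact ⟨hy, hyv⟩
  refine H.not_cone_subset ((subset_of_disjoint_frontier H.isPreconnected_cone (t := B)
    ⟨x, H.Omega_subset_cone hx, hx, rfl⟩ fun y hy hyB => ?_).trans
      (inter_subset_left.trans Omega_subset))
  have hyB' : y ∉ B := fun h => hyB.2 (hBo.interior_eq.symm ▸ h)
  have hval : y ∈ OmegaGamma K W Ω₁ Ω₂ → v y = v x := fun hyG => by
    have h3 : ContinuousWithinAt v B y := (hv1.continuousOn y hyG).mono
      fun z hz => Or.inl (Or.inl (Or.inl hz.1))
    have h4 := h3.mem_closure hyB.1 (t := {v x}) fun z hz => hz.2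
    rwa [closure_singleton] at h4
  by_cases hyΩ : y ∈ Ω
  · exact hyB' ⟨hyΩ, hval (Or.inl (Or.inl (Or.inl hyΩ)))⟩
  · have hyf : y ∈ frontier Ω :=
      ⟨closure_mono inter_subset_left hyB.1, fun h => hyΩ (interior_subset h)⟩
    rcases H.frontier_inter_cone_subset ⟨hyf, hy⟩ with h | h
    · have h3 := hval (Or.inl (Or.inl (Or.inr h)))
      rw [h0 y h] at h3
      exact absurd hxc (not_lt.2 (h3 ▸ le_max_left _ _))
    · have h3 := hval (Or.inr h)
      rw [h2 y h] at h3
      exact absurd hxc (not_lt.2 (h3 ▸ le_max_right _ _))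

end IsAnnularSectorLike

end

end SpaceForm

end

/-! ### Passage to the boundary and attainment of the maximum. -/

theorem proposition2p1 {n : ℕ} (hn : 2 ≤ n) {K : ℝ} (hK : K = 0 ∨ K = 1 ∨ K = -1)
    {W : Set (Metric.sphere (0 : SpaceForm.E n) 1)} {Ω₁ Ω₂ : Set (SpaceForm.E n)}
    (hΩ : SpaceForm.IsAnnularSectorLike K W Ω₁ Ω₂)
    (c₀ c₂ : ℝ) (v : SpaceForm.E n → ℝ)
    (hv2 : ContDiffOn ℝ 2 v (SpaceForm.Omega Ω₁ Ω₂))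
    (hv1 : ContDiffOn ℝ 1 v (SpaceForm.OmegaGamma K W Ω₁ Ω₂))
    (hvW : SpaceForm.MemW12 K (SpaceForm.Omega Ω₁ Ω₂) v)
    (hlap : ∀ x ∈ SpaceForm.Omega Ω₁ Ω₂, 0 ≤ SpaceForm.laplacian K v x)
    (h0 : ∀ x ∈ SpaceForm.Gamma0 K W Ω₁, v x = c₀)
    (h1 : ∀ x ∈ SpaceForm.Gamma1 K W Ω₁ Ω₂, ∀ ν : SpaceForm.E n,
      SpaceForm.IsOutwardUnitNormal K (SpaceForm.Omega Ω₁ Ω₂) x ν →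
        fderivWithin ℝ v (SpaceForm.OmegaGamma K W Ω₁ Ω₂) x ν ≤ 0)
    (h2 : ∀ x ∈ SpaceForm.Gamma2 K W Ω₂, v x = c₂) :
    IsGreatest (v '' SpaceForm.OmegaGamma K W Ω₁ Ω₂) (max c₀ c₂) ∧
      (ContinuousOn v (closure (SpaceForm.Omega Ω₁ Ω₂) ∩ SpaceForm.M n K) →
        IsGreatest (v '' (closure (SpaceForm.Omega Ω₁ Ω₂) ∩ SpaceForm.M n K)) (max c₀ c₂)) := by
  have hle : ∀ x ∈ SpaceForm.Omega Ω₁ Ω₂, v x ≤ max c₀ c₂ := fun x hx =>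
    hΩ.le_max hn hK hv2 hv1 hvW hlap h0 h1 h2 hx
  have hcl : ∀ s : Set (SpaceForm.E n), SpaceForm.Omega Ω₁ Ω₂ ⊆ s → ContinuousOn v s →
      ∀ x ∈ s, x ∈ closure (SpaceForm.Omega Ω₁ Ω₂) → v x ≤ max c₀ c₂ := by
    intro s hs hv x hx hxc
    have h3 := ((hv x hx).mono hs).mem_closure hxc (t := Set.Iic (max c₀ c₂)) hle
    rwa [isClosed_Iic.closure_eq] at h3
  obtain ⟨p₀, hp₀⟩ := hΩ.Gamma0_nonempty
  -- For the second claim the value `c₂` has to be attained inside `closure Ω`, so an arbitrary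
  -- point of `Γ₂` would not do.
  obtain ⟨p₂, hp₂, hp₂'⟩ := hΩ.Gamma2_inter_closure_nonempty
  constructor
  · constructor
    · rcases max_choice c₀ c₂ with h | h
      · rw [h]; exact ⟨p₀, Or.inl (Or.inl (Or.inr hp₀)), h0 p₀ hp₀⟩
      · rw [h]; exact ⟨p₂, Or.inr hp₂, h2 p₂ hp₂⟩
    · rintro _ ⟨x, hx, rfl⟩
      rcases id hx with ((h | h) | h) | h
      · exact hle x h
      · rw [h0 x h]; exact le_max_left _ _
      · exact hcl _ (fun y hy => Or.inl (Or.inl (Or.inl hy))) hv1.continuousOn x hx h.1.1.1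
      · rw [h2 x h]; exact le_max_right _ _
  · intro hv
    constructor
    · rcases max_choice c₀ c₂ with h | h
      · rw [h]
        exact ⟨p₀, ⟨hΩ.Gamma0_subset_closure hp₀, hp₀.2.1⟩, h0 p₀ hp₀⟩
      · rw [h]
        exact ⟨p₂, ⟨hp₂', hp₂.2.1⟩, h2 p₂ hp₂⟩
    · rintro _ ⟨x, hx, rfl⟩
      exact hcl (closure (SpaceForm.Omega Ω₁ Ω₂) ∩ SpaceForm.M n K) (fun y hy => ⟨subset_closure hy,
        hΩ.closure_Omega_subset_M hK (subset_closure hy)⟩) hv x hx hx.1
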